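/- Let $\eta\ge 0$, let $n\ge 0$, and equip $\mathbb R^n$ with any norm $\|\cdot\|$. Let $BUC_\eta$ be the Banach space of continuous functions $\varphi:(-\infty,0]\to\mathbb R^n$ such that $\theta\mapsto e^{\eta\theta}\varphi(\theta)$ is bounded and uniformly continuous, with the norm $\|\varphi\|_\eta=\sup_{\theta\le 0}e^{\eta\theta}\|\varphi(\theta)\|$, and let $BUC_\eta^1$ be the set of $\varphi\in C^1((-\infty,0],\mathbb R^n)$ with $\varphi,\varphi'\in BUC_\eta$. Let $X=\mathbb R^n\times BUC_\eta$ with the norm $\|(\alpha,\varphi)\|=\|\alpha\|+\|\varphi\|_\eta$, and let $A:D(A)\subset X\to X$ be the operator $$A(0,\varphi)=(-\varphi'(0),\varphi'),\qquad D(A)=\{0\}\times BUC_\eta^1 .$$ Let $X_0=\overline{D(A)}$, let $\widehat L:BUC_\eta\to\mathbb R^n$ be a bounded linear operator, and let $L:X_0\to X$ be given by $L(0,\varphi)=(\widehat L\varphi,0)$. Let $A_0$ and $(A+L)_0$ be the parts of $A$ and of $A+L$ in $X_0$, where the part of an operator $B$ in $X_0$ is its restriction to $\{x\in D(B)\cap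 X_0: Bx\in X_0\}$. For a bounded linear operator $T$ on a Banach space $Z$, let $\|T\|_{ess}$ be the infimum of the $\varepsilon>0$ such that the image under $T$ of the closed unit ball of $Z$ can be covered by finitely many balls of radius at most $\varepsilon$. For the generator $B$ of a $C_0$-semigroup $\{T_B(t)\}_{t\ge0}$, let $$\omega_{0,ess}(B)=\lim_{t\to+\infty}\frac{\ln\|T_B(t)\|_{ess}}{t}\in[-\infty,+\infty),\qquad \ln 0=-\infty .$$ Then $A_0$ and $(A+L)_0$ are infinitesimal generators of $C_0$-semigroups of bounded linear operators on $X_0$, the limits defining their essential growth bounds exist, and $$\omega_{0,ess}\big((A+L)_0\big)\le\omega_{0,ess}(A_0)\le-\eta .$$ -/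

import Mathlib

open Set Filter Topology
open scoped NNReal ENNReal

noncomputable section

namespace InfiniteDelay

/-! ### The weighted space of bounded uniformly continuous functions -/

section Space

variable (η : ℝ) (E : Type*) [NormedAddCommGroup E] [NormedSpace ℝ E]

/-- The continuous functions `φ : (-∞, 0] → E` such that `θ ↦ exp (η θ) φ(θ)` is bounded and
uniformly continuous, as a linear subspace of the space of all continuous functions. -/
def bucSubmodule : Submodule ℝ C(Iic (0 : ℝ), E) where
  carrier := {φ | (∃ C : ℝ, ∀ θ : Iic (0 : ℝ), ‖Real.exp (η * θ) • φ θ‖ ≤ C) ∧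
    UniformContinuous fun θ : Iic (0 : ℝ) => Real.exp (η * θ) • φ θ}
  zero_mem' := ⟨⟨0, fun θ => by simp⟩, by simpa using uniformContinuous_const⟩
  add_mem' := by
    rintro φ ψ ⟨⟨C, hC⟩, hφ⟩ ⟨⟨D, hD⟩, hψ⟩
    refine ⟨⟨C + D, fun θ => ?_⟩, ?_⟩
    · rw [ContinuousMap.add_apply, smul_add]
      exact (norm_add_le _ _).trans (add_le_add (hC θ) (hD θ))
    · simpa only [ContinuousMap.add_apply, smul_add] using hφ.add hψ
  smul_mem' := by
    rintro c φ ⟨⟨C, hC⟩, hφ⟩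
    refine ⟨⟨‖c‖ * C, fun θ => ?_⟩, ?_⟩
    · rw [ContinuousMap.smul_apply, smul_comm, norm_smul]
      exact mul_le_mul_of_nonneg_left (hC θ) (norm_nonneg c)
    · simp only [ContinuousMap.smul_apply, smul_comm _ c]
      exact hφ.const_smul c

/-- The space `BUC_η` of functions `(-∞, 0] → E`. -/
def BUC : Type _ := ↥(bucSubmodule η E)

instance : AddCommGroup (BUC η E) := inferInstanceAs (AddCommGroup ↥(bucSubmodule η E))

instance : Module ℝ (BUC η E) := inferInstanceAs (Module ℝ ↥(bucSubmodule η E))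

instance : CoeFun (BUC η E) fun _ => Iic (0 : ℝ) → E := ⟨fun φ => φ.1⟩

variable {η E}

theorem BUC.ext {φ ψ : BUC η E} (h : ∀ θ, φ θ = ψ θ) : φ = ψ :=
  Subtype.ext (ContinuousMap.ext h)

theorem BUC.add_apply (φ ψ : BUC η E) (θ : Iic (0 : ℝ)) : (φ + ψ) θ = φ θ + ψ θ := rfl

theorem BUC.smul_apply (c : ℝ) (φ : BUC η E) (θ : Iic (0 : ℝ)) : (c • φ) θ = c • φ θ := rfl

variable (η E)

/-- `φ ↦ (θ ↦ exp (η θ) φ(θ))`, with values in the bounded continuous functions. -/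
def weighted : BUC η E →ₗ[ℝ] BoundedContinuousFunction (Iic (0 : ℝ)) E where
  toFun φ := BoundedContinuousFunction.ofNormedAddCommGroup
    (fun θ : Iic (0 : ℝ) => Real.exp (η * θ) • φ θ) φ.2.2.continuous
    φ.2.1.choose φ.2.1.choose_spec
  map_add' φ ψ := by
    ext θ
    exact smul_add (Real.exp (η * θ)) (φ θ) (ψ θ)
  map_smul' c φ := by
    ext θ
    exact smul_comm (Real.exp (η * θ)) c (φ θ)

theorem weighted_injective : Function.Injective (weighted η E) := by
  intro φ ψ h
  refine BUC.ext fun θ => ?_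
  have h' : Real.exp (η * θ) • φ θ = Real.exp (η * θ) • ψ θ :=
    congrArg (fun f : BoundedContinuousFunction (Iic (0 : ℝ)) E => f θ) h
  exact smul_right_injective E (Real.exp_pos _).ne' h'

/-- The weighted supremum norm; see `BUC.norm_eq`. -/
instance : NormedAddCommGroup (BUC η E) :=
  NormedAddCommGroup.induced _ _ (weighted η E) (weighted_injective η E)

instance : NormedSpace ℝ (BUC η E) := NormedSpace.induced ℝ _ _ (weighted η E)

variable {η E}

theorem BUC.norm_eq (φ : BUC η E) :
    ‖φ‖ = ⨆ θ : Iic (0 : ℝ), Real.exp (η * θ) * ‖φ θ‖ := by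
  have h : ‖φ‖ = ‖weighted η E φ‖ := rfl
  rw [h, BoundedContinuousFunction.norm_eq_iSup_norm]
  refine iSup_congr fun θ => ?_
  have h' : weighted η E φ θ = Real.exp (η * θ) • φ θ := rfl
  rw [h', norm_smul, Real.norm_of_nonneg (Real.exp_pos _).le]

variable (η E)

/-- `X = E × BUC_η` with the sum norm `‖(α, φ)‖ = ‖α‖ + ‖φ‖_η`. -/
abbrev State : Type _ := WithLp 1 (E × BUC η E)

end Space

/-! ### The operators -/

section Operators

variable {η : ℝ} {E : Type*} [NormedAddCommGroup E] [NormedSpace ℝ E]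

/-- `ψ` is the derivative of `φ` on `(-∞, 0]` (one-sided at `0`). -/
def IsDerivative (φ ψ : BUC η E) : Prop :=
  ∀ θ : Iic (0 : ℝ), HasDerivWithinAt (IicExtend φ) (ψ θ) (Iic 0) θ

theorem IsDerivative.unique {φ ψ ψ' : BUC η E} (h : IsDerivative φ ψ)
    (h' : IsDerivative φ ψ') : ψ = ψ' :=
  BUC.ext fun θ => (uniqueDiffOn_Iic (0 : ℝ) θ θ.2).eq_deriv _ (h θ) (h' θ)

theorem IsDerivative.add {φ₁ φ₂ ψ₁ ψ₂ : BUC η E} (h₁ : IsDerivative φ₁ ψ₁)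
    (h₂ : IsDerivative φ₂ ψ₂) : IsDerivative (φ₁ + φ₂) (ψ₁ + ψ₂) :=
  fun θ => (h₁ θ).add (h₂ θ)

theorem IsDerivative.smul {φ ψ : BUC η E} (c : ℝ) (h : IsDerivative φ ψ) :
    IsDerivative (c • φ) (c • ψ) :=
  fun θ => (h θ).const_smul c

theorem IsDerivative.zero : IsDerivative (0 : BUC η E) 0 :=
  fun θ => hasDerivWithinAt_const (θ : ℝ) (Iic 0) (0 : E)

variable (η E)

/-- `BUC_η¹`: the `C¹` functions `φ` with both `φ` and `φ'` in `BUC_η`. -/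
def BUC1 : Submodule ℝ (BUC η E) where
  carrier := {φ | ∃ ψ : BUC η E, IsDerivative φ ψ}
  zero_mem' := ⟨0, IsDerivative.zero⟩
  add_mem' := fun ⟨ψ₁, h₁⟩ ⟨ψ₂, h₂⟩ => ⟨ψ₁ + ψ₂, h₁.add h₂⟩
  smul_mem' := fun c _ ⟨ψ, h⟩ => ⟨c • ψ, h.smul c⟩

/-- The derivative `φ ↦ φ'` from `BUC_η¹` to `BUC_η`. -/
def derivative : BUC1 η E →ₗ[ℝ] BUC η E where
  toFun φ := φ.2.choose
  map_add' φ₁ φ₂ :=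
    (φ₁ + φ₂).2.choose_spec.unique (φ₁.2.choose_spec.add φ₂.2.choose_spec)
  map_smul' c φ := (c • φ).2.choose_spec.unique (φ.2.choose_spec.smul c)

theorem derivative_spec (φ : BUC1 η E) : IsDerivative φ.1 (derivative η E φ) :=
  φ.2.choose_spec

/-- The domain `D(A) = {0} × BUC_η¹`. -/
def domA : Submodule ℝ (State η E) where
  carrier := {x | x.fst = 0 ∧ x.snd ∈ BUC1 η E}
  zero_mem' := ⟨rfl, (BUC1 η E).zero_mem⟩
  add_mem' := by
    rintro x y ⟨hx, hx'⟩ ⟨hy, hy'⟩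
    exact ⟨by simp [hx, hy], (BUC1 η E).add_mem hx' hy'⟩
  smul_mem' := by
    rintro c x ⟨hx, hx'⟩
    exact ⟨by simp [hx], (BUC1 η E).smul_mem c hx'⟩

/-- The operator `A (0, φ) = (-φ'(0), φ')` on `D(A) = {0} × BUC_η¹`. -/
def opA : State η E →ₗ.[ℝ] State η E where
  domain := domA η E
  toFun :=
    { toFun := fun x => WithLp.toLp 1
        (-(derivative η E ⟨x.1.snd, x.2.2⟩ ⟨0, mem_Iic.mpr le_rfl⟩), derivative η E ⟨x.1.snd, x.2.2⟩)
      map_add' := fun x y => by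
        have h : derivative η E ⟨(x + y).1.snd, (x + y).2.2⟩
            = derivative η E ⟨x.1.snd, x.2.2⟩ + derivative η E ⟨y.1.snd, y.2.2⟩ :=
          (derivative η E).map_add ⟨x.1.snd, x.2.2⟩ ⟨y.1.snd, y.2.2⟩
        rw [h, BUC.add_apply, neg_add]
        rfl
      map_smul' := fun c x => by
        have h : derivative η E ⟨(c • x).1.snd, (c • x).2.2⟩
            = c • derivative η E ⟨x.1.snd, x.2.2⟩ :=
          (derivative η E).map_smul c ⟨x.1.snd, x.2.2⟩
        rw [h, BUC.smul_apply, ← smul_neg]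
        rfl }

/-- `X₀`, the closure of `D(A)` in `X`. -/
def closDom : Submodule ℝ (State η E) := (opA η E).domain.topologicalClosure

variable {η E}

/-- The operator `L (0, φ) = (L̂ φ, 0)`, with domain the closure of `D(A)`. -/
def opL (Lhat : BUC η E →L[ℝ] E) : State η E →ₗ.[ℝ] State η E where
  domain := closDom η E
  toFun :=
    { toFun := fun x => WithLp.toLp 1 (Lhat x.1.snd, 0)
      map_add' := fun x y => by
        have h : Lhat (x + y).1.snd = Lhat x.1.snd + Lhat y.1.snd :=
          Lhat.map_add x.1.snd y.1.snd
        rw [h, ← WithLp.toLp_add, Prod.mk_add_mk, add_zero]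
      map_smul' := fun c x => by
        have h : Lhat (c • x).1.snd = c • Lhat x.1.snd := Lhat.map_smul c x.1.snd
        rw [h, RingHom.id_apply, ← WithLp.toLp_smul, Prod.smul_mk, smul_zero] }

end Operators

/-! ### Parts of operators, semigroups, generators, essential growth bounds -/

section Abstract

variable {Z : Type*} [NormedAddCommGroup Z] [NormedSpace ℝ Z]

/-- The part of the operator `B` in the subspace `Y`: the restriction of `B` to
`{x ∈ D(B) ∩ Y : B x ∈ Y}`, as an operator in `Y`. -/
def part (B : Z →ₗ.[ℝ] Z) (Y : Submodule ℝ Z) : Y →ₗ.[ℝ] Y where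
  domain :=
    { carrier := {y | ∃ h : (y : Z) ∈ B.domain, B ⟨y, h⟩ ∈ Y}
      zero_mem' := ⟨B.domain.zero_mem, by
        have h : B ⟨((0 : Y) : Z), B.domain.zero_mem⟩ = 0 := B.map_zero
        rw [h]
        exact Y.zero_mem⟩
      add_mem' := by
        rintro x y ⟨hx, hx'⟩ ⟨hy, hy'⟩
        refine ⟨B.domain.add_mem hx hy, ?_⟩
        have h : B ⟨((x + y : Y) : Z), B.domain.add_mem hx hy⟩ = B ⟨x, hx⟩ + B ⟨y, hy⟩ :=
          B.map_add ⟨x, hx⟩ ⟨y, hy⟩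
        rw [h]
        exact Y.add_mem hx' hy'
      smul_mem' := by
        rintro c x ⟨hx, hx'⟩
        refine ⟨B.domain.smul_mem c hx, ?_⟩
        have h : B ⟨((c • x : Y) : Z), B.domain.smul_mem c hx⟩ = c • B ⟨x, hx⟩ :=
          B.map_smul c ⟨x, hx⟩
        rw [h]
        exact Y.smul_mem c hx' }
  toFun :=
    { toFun := fun y => ⟨B ⟨y.1, y.2.choose⟩, y.2.choose_spec⟩
      map_add' := fun x y => Subtype.ext
        (B.map_add ⟨x.1, x.2.choose⟩ ⟨y.1, y.2.choose⟩)
      map_smul' := fun c x => Subtype.ext (B.map_smul c ⟨x.1, x.2.choose⟩) }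

variable (Z) in
/-- A strongly continuous semigroup of bounded linear operators. -/
structure C0Semigroup where
  toFun : ℝ≥0 → Z →L[ℝ] Z
  map_zero : toFun 0 = ContinuousLinearMap.id ℝ Z
  map_add : ∀ s t, toFun (s + t) = (toFun s).comp (toFun t)
  continuous : ∀ x, Continuous fun t => toFun t x

/-- `B` is the infinitesimal generator of `T`: the graph of `B` consists of the pairs `(x, y)`
such that `(T(t) x - x) / t → y` as `t → 0⁺`. -/
def C0Semigroup.HasGenerator (T : C0Semigroup Z) (B : Z →ₗ.[ℝ] Z) : Prop :=
  ∀ x y : Z, (x, y) ∈ B.graph ↔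
    Tendsto (fun t : ℝ≥0 => (t : ℝ)⁻¹ • (T.toFun t x - x)) (𝓝[>] 0) (𝓝 y)

/-- The (ball) measure of noncompactness: the infimum of the `ε > 0` such that `S` is covered by
finitely many balls of radius at most `ε`. -/
def noncompactnessMeasure (S : Set Z) : ℝ≥0∞ :=
  ⨅ (ε : ℝ≥0) (_ : 0 < ε ∧ ∃ F : Finset Z, S ⊆ ⋃ c ∈ F, Metric.closedBall c ε), (ε : ℝ≥0∞)

/-- The essential norm of a bounded operator. -/
def essNorm (T : Z →L[ℝ] Z) : ℝ≥0∞ := noncompactnessMeasure (T '' Metric.closedBall 0 1)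

/-- `ω` is the essential growth bound of the semigroup `T`, that is, the limit of
`ln ‖T(t)‖_ess / t` as `t → +∞`, with `ln 0 = -∞`. -/
def C0Semigroup.HasEssGrowthBound (T : C0Semigroup Z) (ω : EReal) : Prop :=
  Tendsto (fun t : ℝ≥0 => ENNReal.log (essNorm (T.toFun t)) / ((t : ℝ) : EReal)) atTop (𝓝 ω)

end Abstract

end InfiniteDelay

end

noncomputable section

namespace InfiniteDelay

open scoped BoundedContinuousFunction

/-! ### Right derivatives along nonnegative increments -/

/-! The closure `X₀` is `{0} × BUC_η`, and membership of `(A + L)(0, φ)` in it forces `φ'(0) = L φ`.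
So `(A + L)_0` is differentiation with this boundary condition, and its semigroup is the history
semigroup of the delay equation `x' = L xₜ`; `A_0` is the case `L = 0`.

The semigroup is built explicitly. The history at time `t` is `φ` translated and frozen at `φ(0)`,
plus the integral of a density representing `L xₜ`. After an exponential weight, the density solves
a renewal equation whose operator has norm less than one. Uniqueness of its solution gives the
semigroup law (`solution_add`), and `genRel_solutionSemigroup_iff` computes the generator.

For the essential norm of the solution operator `U(t)`, no perturbation theorem is needed. Up to an
error of norm `2 exp (-η t)`, `U(t) φ` is a segment of the trajectory on `[0, t]`, and these
trajectories form a totally bounded set by Arzelà–Ascoli (`essNorm_solution_le`). Conversely `U(t)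
φ` still contains all of `φ`, shifted by `t`, so norms shrink by at most `exp (-η t)`, and a
separated sequence bounds the essential norm from below (`le_essNorm_solution`). Hence both growth
bounds equal `-η`, or `-∞` if the space `E` is trivial.

Since a generator determines its semigroup (`C0Semigroup.eq_of_genRel`), the result holds for every
semigroup with these generators. -/

theorem map_add_coe_nhdsGT_zero (a : ℝ) :
    map (fun t : ℝ≥0 => a + (t : ℝ)) (𝓝[>] 0) = 𝓝[>] a := by
  have he : IsEmbedding (fun t : ℝ≥0 => a + (t : ℝ)) :=
    (Homeomorph.addLeft a).isEmbedding.comp IsEmbedding.subtypeVal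
  rw [he.map_nhdsWithin_eq]
  have h : (fun t : ℝ≥0 => a + (t : ℝ)) '' Ioi 0 = Ioi a := by
    ext s
    constructor
    · rintro ⟨t, ht, rfl⟩
      have : (0 : ℝ) < t := ht
      simpa using this
    · intro hs
      have hs' : a < s := hs
      refine ⟨⟨s - a, by linarith⟩, ?_, by change a + (s - a) = s; ring⟩
      change (0 : ℝ) < s - a
      linarith
  rw [h]
  simp

/-- Identifies the limits over `ℝ≥0` that define generators with right derivatives, so that calculus
on `ℝ` applies to them. -/
theorem hasDerivWithinAt_Ici_iff_tendsto {Z : Type*} [NormedAddCommGroup Z] [NormedSpace ℝ Z]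
    {g : ℝ → Z} {g' : Z} {a : ℝ} :
    HasDerivWithinAt g g' (Ici a) a ↔
      Tendsto (fun t : ℝ≥0 => (t : ℝ)⁻¹ • (g (a + t) - g a)) (𝓝[>] 0) (𝓝 g') := by
  rw [hasDerivWithinAt_iff_tendsto_slope, Ici_sdiff_left, ← map_add_coe_nhdsGT_zero,
    tendsto_map'_iff]
  refine tendsto_congr fun t => ?_
  simp [slope_def_module]

/-! ### Uniqueness of the semigroup with a given generator -/

section Abstract

variable {Z : Type*} [NormedAddCommGroup Z] [NormedSpace ℝ Z]

namespace C0Semigroup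

/-- `(x, y)` belongs to the graph of the infinitesimal generator of `T`. -/
def GenRel (T : C0Semigroup Z) (x y : Z) : Prop :=
  Tendsto (fun t : ℝ≥0 => (t : ℝ)⁻¹ • (T.toFun t x - x)) (𝓝[>] 0) (𝓝 y)

theorem map_add_apply (T : C0Semigroup Z) (s t : ℝ≥0) (x : Z) :
    T.toFun (s + t) x = T.toFun s (T.toFun t x) := by
  rw [T.map_add]; rfl

theorem map_zero_apply (T : C0Semigroup Z) (x : Z) : T.toFun 0 x = x := by
  rw [T.map_zero]; rfl

theorem exists_bound [CompleteSpace Z] (T : C0Semigroup Z) (b : ℝ≥0) :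
    ∃ C, 0 ≤ C ∧ ∀ t ≤ b, ‖T.toFun t‖ ≤ C := by
  obtain ⟨C, hC⟩ := banach_steinhaus (g := fun t : Icc (0 : ℝ≥0) b => T.toFun t) (fun x => by
    obtain ⟨C, hC⟩ := (isCompact_Icc (a := (0 : ℝ≥0)) (b := b)).exists_bound_of_continuousOn
      (T.continuous x).continuousOn
    exact ⟨C, fun t => hC t t.2⟩)
  exact ⟨C, (norm_nonneg _).trans (hC ⟨0, le_rfl, zero_le⟩), fun t ht => hC ⟨t, zero_le, ht⟩⟩

theorem GenRel.map {T : C0Semigroup Z} {x y : Z} (h : T.GenRel x y) (s : ℝ≥0) :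
    T.GenRel (T.toFun s x) (T.toFun s y) := by
  have h' := ((T.toFun s).continuous.tendsto y).comp h
  refine h'.congr fun t => ?_
  simp only [Function.comp, map_smul, map_sub]
  rw [← T.map_add_apply, ← T.map_add_apply, add_comm]

/-- The domain of the infinitesimal generator is dense. -/
theorem dense_genRel [CompleteSpace Z] (T : C0Semigroup Z) :
    Dense {x | ∃ y, T.GenRel x y} := by
  intro x
  set u : ℝ → Z := fun s => T.toFun s.toNNReal x with hu
  have huc : Continuous u := (T.continuous x).comp continuous_real_toNNReal
  set F : ℝ → Z := fun h => ∫ s in (0 : ℝ)..h, u s with hF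
  have hFd : ∀ s, HasDerivAt F (u s) s := fun s => huc.integral_hasStrictDerivAt 0 s |>.hasDerivAt
  -- `T(r)` only moves the interval of integration. Differentiability of `F` therefore puts every `F
  -- h` in the domain, and `h⁻¹ F h` tends to `x`.
  have hTF : ∀ (r h : ℝ≥0), T.toFun r (F h) = F (r + h) - F r := by
    intro r h
    have h1 : T.toFun r (F h) = ∫ s in (0 : ℝ)..h, u (r + s) := by
      rw [hF, ← ContinuousLinearMap.intervalIntegral_comp_comm _ (huc.intervalIntegrable _ _)]
      refine intervalIntegral.integral_congr fun s hs => ?_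
      rw [uIcc_of_le h.coe_nonneg] at hs
      simp only [hu]
      rw [Real.toNNReal_add r.coe_nonneg hs.1, T.map_add_apply, Real.toNNReal_coe]
    rw [h1, intervalIntegral.integral_comp_add_left (fun s => u s),
      ← intervalIntegral.integral_interval_sub_left (huc.intervalIntegrable 0 _)
        (huc.intervalIntegrable 0 _)]
    simp [hF]
  have hmem : ∀ h : ℝ≥0, ∃ y, T.GenRel (F h) y := by
    intro h
    refine ⟨u h - u 0, ?_⟩
    have h1 : HasDerivAt (fun r => F (r + h) - F r) (u h - u 0) 0 := by
      refine HasDerivAt.sub ?_ (hFd 0)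
      exact HasDerivAt.comp_add_const 0 (h : ℝ) (by simpa using hFd h)
    have h2 := hasDerivWithinAt_Ici_iff_tendsto.1 (h1.hasDerivWithinAt (s := Ici 0))
    refine h2.congr fun r => ?_
    rw [hTF]
    simp [hF]
  have hlim : Tendsto (fun h : ℝ≥0 => (h : ℝ)⁻¹ • F h) (𝓝[>] 0) (𝓝 x) := by
    have h2 := hasDerivWithinAt_Ici_iff_tendsto.1 ((hFd 0).hasDerivWithinAt (s := Ici 0))
    have h3 : u 0 = x := by simp [hu, T.map_zero_apply]
    rw [h3] at h2
    refine h2.congr fun r => ?_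
    simp [hF]
  refine mem_closure_of_tendsto hlim (Eventually.of_forall fun h => ?_)
  obtain ⟨y, hy⟩ := hmem h
  refine ⟨(h : ℝ)⁻¹ • y, ?_⟩
  refine (hy.const_smul (h : ℝ)⁻¹).congr fun t => ?_
  simp only [map_smul]
  rw [← smul_sub, smul_comm]

/-- The curve `s ↦ T(t - s) S(s) x` joins `T(t) x` to `S(t) x` and has right derivative zero,
because both generators take the same value at `S(s) x`. -/
theorem eq_on_genRel [CompleteSpace Z] {S T : C0Semigroup Z}
    (hST : ∀ x y, S.GenRel x y → T.GenRel x y) {x y : Z} (hx : S.GenRel x y) (t : ℝ≥0) :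
    S.toFun t x = T.toFun t x := by
  obtain ⟨C, hC0, hC⟩ := T.exists_bound t
  set v : ℝ → Z := fun s => T.toFun (t - s).toNNReal (S.toFun s.toNNReal x) with hv
  have hle : ∀ s : ℝ, 0 ≤ s → ((t : ℝ) - s).toNNReal ≤ t := fun s hs =>
    Real.toNNReal_le_iff_le_coe.2 (by linarith)
  have hcont : ContinuousOn v (Icc 0 t) := by
    intro s hs
    have h1 : Tendsto (fun r : ℝ => T.toFun (t - r).toNNReal (S.toFun s.toNNReal x))
        (𝓝[Icc 0 (t : ℝ)] s) (𝓝 (v s)) := by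
      have : Continuous fun r : ℝ => T.toFun (t - r).toNNReal (S.toFun s.toNNReal x) :=
        (T.continuous _).comp (continuous_real_toNNReal.comp (continuous_const.sub continuous_id))
      exact (this.tendsto s).mono_left nhdsWithin_le_nhds
    have h2 : Tendsto (fun r : ℝ => T.toFun (t - r).toNNReal
        (S.toFun r.toNNReal x - S.toFun s.toNNReal x)) (𝓝[Icc 0 (t : ℝ)] s) (𝓝 0) := by
      have h3 : Tendsto (fun r : ℝ => C * ‖S.toFun r.toNNReal x - S.toFun s.toNNReal x‖)
          (𝓝[Icc 0 (t : ℝ)] s) (𝓝 0) := by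
        have : Continuous fun r : ℝ => C * ‖S.toFun r.toNNReal x - S.toFun s.toNNReal x‖ :=
          continuous_const.mul ((((S.continuous _).comp continuous_real_toNNReal).sub
            continuous_const).norm)
        have h4 := (this.tendsto s).mono_left (nhdsWithin_le_nhds (s := Icc 0 (t : ℝ)))
        simpa using h4
      refine squeeze_zero_norm' ?_ h3
      filter_upwards [self_mem_nhdsWithin] with r hr
      exact (T.toFun _).le_of_opNorm_le (hC _ (hle r hr.1)) _
    have h5 := h1.add h2
    rw [add_zero] at h5
    refine h5.congr fun r => ?_
    simp [hv]
  have hder : ∀ s ∈ Ico (0 : ℝ) t, HasDerivWithinAt v 0 (Ici s) s := by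
    intro s hs
    rw [hasDerivWithinAt_Ici_iff_tendsto]
    set z := S.toFun s.toNNReal x with hz
    have hzS : S.GenRel z (S.toFun s.toNNReal y) := hx.map _
    have hzT := hST _ _ hzS
    have hdiff : Tendsto (fun h : ℝ≥0 => C * ‖(h : ℝ)⁻¹ • (S.toFun h z - z)
        - (h : ℝ)⁻¹ • (T.toFun h z - z)‖) (𝓝[>] 0) (𝓝 0) := by
      have := ((Tendsto.sub hzS hzT).norm).const_mul C
      simpa using this
    refine squeeze_zero_norm' ?_ hdiff
    have hsmall : ∀ᶠ h : ℝ≥0 in 𝓝[>] 0, h < (t - s).toNNReal :=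
      nhdsWithin_le_nhds (Iio_mem_nhds (Real.toNNReal_pos.2 (by linarith [hs.2])))
    filter_upwards [hsmall] with h hh
    have hh' : (h : ℝ) < t - s := Real.lt_toNNReal_iff_coe_lt.1 hh
    have e1 : (s + (h : ℝ)).toNNReal = h + s.toNNReal := by
      rw [Real.toNNReal_add hs.1 h.coe_nonneg, Real.toNNReal_coe, add_comm]
    have e2 : ((t : ℝ) - s).toNNReal = ((t : ℝ) - (s + h)).toNNReal + h := by
      have e := Real.toNNReal_add (r := (t : ℝ) - (s + h)) (by linarith) h.coe_nonneg
      rw [Real.toNNReal_coe] at e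
      rw [← e]
      congr 1
      ring
    -- Pulling out the operator at the shorter time `t - (s + h)` leaves two difference quotients
    -- with the same limit; the uniform bound `C` on `[0, t]` controls the operator.
    have e3 : (h : ℝ)⁻¹ • (v (s + h) - v s) = T.toFun ((t : ℝ) - (s + h)).toNNReal
        ((h : ℝ)⁻¹ • (S.toFun h z - z) - (h : ℝ)⁻¹ • (T.toFun h z - z)) := by
      simp only [hv]
      rw [e1, S.map_add_apply, e2, T.map_add_apply, ← hz, ← smul_sub, map_smul, ← map_sub]
      congr 2
      abel
    rw [e3]
    exact (T.toFun _).le_of_opNorm_le (hC _ (hle _ (by linarith [hs.1, h.coe_nonneg]))) _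
  have h := constant_of_has_deriv_right_zero hcont hder t ⟨t.2, le_rfl⟩
  simpa [hv, T.map_zero_apply, S.map_zero_apply] using h

/-- A semigroup is determined by its infinitesimal generator. -/
theorem eq_of_genRel [CompleteSpace Z] {S T : C0Semigroup Z}
    (hST : ∀ x y, S.GenRel x y → T.GenRel x y) (t : ℝ≥0) : S.toFun t = T.toFun t := by
  refine ContinuousLinearMap.ext_on (s := {x | ∃ y, S.GenRel x y}) ?_ ?_
  · exact S.dense_genRel.mono Submodule.subset_span
  · rintro x ⟨y, hy⟩
    exact eq_on_genRel hST hy t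

end C0Semigroup

end Abstract

/-! ### Uniform continuity of products -/

open scoped Uniformity in
theorem uniformContinuous_smul_of_bounded {α E : Type*} [UniformSpace α] [NormedAddCommGroup E]
    [NormedSpace ℝ E] {f : α → ℝ} {g : α → E} (hf : UniformContinuous f)
    (hg : UniformContinuous g) {A B : ℝ} (hA : ∀ x, ‖f x‖ ≤ A) (hB : ∀ x, ‖g x‖ ≤ B) :
    UniformContinuous fun x => f x • g x := by
  have hf' := tendsto_uniformity_iff_dist_tendsto_zero.1 hf
  have hg' := tendsto_uniformity_iff_dist_tendsto_zero.1 hg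
  refine tendsto_uniformity_iff_dist_tendsto_zero.2 ?_
  have h := (hf'.mul_const B).add (hg'.const_mul A)
  rw [zero_mul, mul_zero, add_zero] at h
  refine squeeze_zero (fun _ => dist_nonneg) (fun p => ?_) h
  simp only [dist_eq_norm]
  have e : f p.1 • g p.1 - f p.2 • g p.2 = (f p.1 - f p.2) • g p.1 + f p.2 • (g p.1 - g p.2) := by
    rw [sub_smul, smul_sub]; abel
  rw [e]
  refine (norm_add_le _ _).trans ?_
  rw [norm_smul, norm_smul]
  gcongr
  · exact hB _
  · exact hA _

theorem abs_exp_sub_exp_le {a b : ℝ} (ha : a ≤ 0) (hb : b ≤ 0) :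
    |Real.exp a - Real.exp b| ≤ |a - b| := by
  wlog h : b ≤ a generalizing a b
  · rw [abs_sub_comm, abs_sub_comm a]
    exact this hb ha (le_of_not_ge h)
  rw [abs_of_nonneg (sub_nonneg.2 (Real.exp_le_exp.2 h)), abs_of_nonneg (sub_nonneg.2 h)]
  have h1 : Real.exp b = Real.exp a * Real.exp (b - a) := by rw [← Real.exp_add]; ring_nf
  have h2 := Real.add_one_le_exp (b - a)
  have h3 := Real.exp_le_one_iff.2 ha
  have h4 := Real.exp_pos a
  nlinarith

theorem uniformContinuous_exp_comp {α : Type*} [PseudoMetricSpace α] {g : α → ℝ}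
    (hg : UniformContinuous g) (h0 : ∀ x, g x ≤ 0) : UniformContinuous fun x => Real.exp (g x) := by
  rw [Metric.uniformContinuous_iff] at hg ⊢
  intro ε hε
  obtain ⟨δ, hδ, h⟩ := hg ε hε
  exact ⟨δ, hδ, fun _ _ hxy => (abs_exp_sub_exp_le (h0 _) (h0 _)).trans_lt (h hxy)⟩

/-! ### The Banach space `BUC` -/

section Space

variable {η : ℝ} {E : Type*} [NormedAddCommGroup E] [NormedSpace ℝ E]

theorem BUC.sub_apply (φ ψ : BUC η E) (θ : Iic (0 : ℝ)) : (φ - ψ) θ = φ θ - ψ θ := rfl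

theorem BUC.continuous_coe (φ : BUC η E) : Continuous φ := φ.1.continuous

theorem weighted_apply (φ : BUC η E) (θ : Iic (0 : ℝ)) :
    weighted η E φ θ = Real.exp (η * θ) • φ θ := rfl

theorem norm_weighted (φ : BUC η E) : ‖weighted η E φ‖ = ‖φ‖ := rfl

theorem BUC.norm_apply_le (φ : BUC η E) (θ : Iic (0 : ℝ)) :
    Real.exp (η * θ) * ‖φ θ‖ ≤ ‖φ‖ := by
  have h := (weighted η E φ).norm_coe_le_norm θ
  rwa [weighted_apply, norm_smul, Real.norm_of_nonneg (Real.exp_pos _).le] at h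

theorem BUC.norm_le {φ : BUC η E} {C : ℝ} (hC : 0 ≤ C)
    (h : ∀ θ : Iic (0 : ℝ), Real.exp (η * θ) * ‖φ θ‖ ≤ C) : ‖φ‖ ≤ C := by
  rw [← norm_weighted, BoundedContinuousFunction.norm_le hC]
  intro θ
  rw [weighted_apply, norm_smul, Real.norm_of_nonneg (Real.exp_pos _).le]
  exact h θ

/-- The point `0` of `(-∞, 0]`. -/
abbrev origin : Iic (0 : ℝ) := ⟨0, mem_Iic.mpr le_rfl⟩

theorem BUC.norm_origin_le (φ : BUC η E) : ‖φ origin‖ ≤ ‖φ‖ := by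
  simpa using φ.norm_apply_le origin

theorem BUC.tendsto_apply {ι : Type*} {l : Filter ι} {u : ι → BUC η E} {φ : BUC η E}
    (h : Tendsto u l (𝓝 φ)) (θ : Iic (0 : ℝ)) : Tendsto (fun i => u i θ) l (𝓝 (φ θ)) := by
  rw [tendsto_iff_norm_sub_tendsto_zero] at h ⊢
  have h' := h.const_mul (Real.exp (η * θ))⁻¹
  rw [mul_zero] at h'
  refine squeeze_zero (fun _ => norm_nonneg _) (fun i => ?_) h'
  rw [inv_mul_eq_div, le_div_iff₀ (Real.exp_pos _), mul_comm]
  exact (u i - φ).norm_apply_le θ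

/-- Any bounded uniformly continuous function can be divided by the weight. Completeness of `BUC`
follows, since uniform limits preserve uniform continuity. -/
theorem range_weighted :
    range (weighted η E) =
      {g : BoundedContinuousFunction (Iic (0 : ℝ)) E | UniformContinuous g} := by
  ext g
  constructor
  · rintro ⟨φ, rfl⟩
    exact φ.2.2
  · intro hg
    have key : (fun θ : Iic (0 : ℝ) => Real.exp (η * θ) • Real.exp (-(η * θ)) • g θ) = g := by
      funext θ
      rw [smul_smul, ← Real.exp_add, add_neg_cancel, Real.exp_zero, one_smul]
    refine ⟨⟨⟨fun θ => Real.exp (-(η * θ)) • g θ, ?_⟩, ⟨‖g‖, fun θ => ?_⟩, ?_⟩, ?_⟩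
    · have := g.continuous
      fun_prop
    · have := congrFun key θ
      rw [ContinuousMap.coe_mk, this]
      exact g.norm_coe_le_norm θ
    · simp only [ContinuousMap.coe_mk]
      rw [key]
      exact hg
    · ext θ
      exact congrFun key θ

theorem isometry_weighted : Isometry (weighted η E) :=
  AddMonoidHomClass.isometry_of_norm _ norm_weighted

instance [CompleteSpace E] : CompleteSpace (BUC η E) := by
  refine (completeSpace_iff_isComplete_range isometry_weighted.isUniformInducing).2 ?_
  rw [range_weighted]
  refine IsClosed.isComplete (isClosed_of_closure_subset fun g hg => ?_)
  obtain ⟨u, hu, hlim⟩ := mem_closure_iff_seq_limit.1 hg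
  exact (BoundedContinuousFunction.tendsto_iff_tendstoUniformly.1 hlim).uniformContinuous
    (Frequently.of_forall hu)

/-- Bounded uniformly continuous functions belong to `BUC_η` for `η ≥ 0`. -/
def BUC.ofBounded (hη : 0 ≤ η) (f : Iic (0 : ℝ) → E) (hf : UniformContinuous f)
    (hb : ∃ C, ∀ θ, ‖f θ‖ ≤ C) : BUC η E :=
  ⟨⟨f, hf.continuous⟩, by
    obtain ⟨C, hC⟩ := hb
    have h1 : ∀ θ : Iic (0 : ℝ), ‖Real.exp (η * θ)‖ ≤ 1 := fun θ => by
      rw [Real.norm_of_nonneg (Real.exp_pos _).le, Real.exp_le_one_iff]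
      exact mul_nonpos_of_nonneg_of_nonpos hη θ.2
    refine ⟨⟨C, fun θ => ?_⟩, ?_⟩
    · rw [norm_smul]
      exact (mul_le_of_le_one_left (norm_nonneg _) (h1 θ)).trans (hC θ)
    · refine uniformContinuous_smul_of_bounded ?_ hf h1 hC
      exact uniformContinuous_exp_comp (uniformContinuous_subtype_val.const_mul' η)
        fun θ => mul_nonpos_of_nonneg_of_nonpos hη θ.2⟩

theorem exp_mul_le_one (hη : 0 ≤ η) (θ : Iic (0 : ℝ)) : Real.exp (η * θ) ≤ 1 :=
  Real.exp_le_one_iff.2 (mul_nonpos_of_nonneg_of_nonpos hη θ.2)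

theorem BUC.norm_le_of_norm_apply_le (hη : 0 ≤ η) {φ : BUC η E} {C : ℝ} (hC : 0 ≤ C)
    (h : ∀ θ, ‖φ θ‖ ≤ C) : ‖φ‖ ≤ C :=
  BUC.norm_le hC fun θ =>
    (mul_le_of_le_one_left (norm_nonneg _) (exp_mul_le_one hη θ)).trans (h θ)

/-! ### Segments of functions given on `[0, t]` -/

/-- For `y : [0, t] → E`, the function `θ ↦ y(t + θ)` on `[-t, 0]`, constant on `(-∞, -t]`. -/
def segment (hη : 0 ≤ η) (t : ℝ≥0) (y : BoundedContinuousFunction (Icc (0 : ℝ) t) E) :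
    BUC η E :=
  BUC.ofBounded hη (fun θ => y (projIcc 0 (t : ℝ) t.coe_nonneg (t + θ)))
    ((CompactSpace.uniformContinuous_of_continuous y.continuous).comp
      ((LipschitzWith.projIcc _).uniformContinuous.comp
        (uniformContinuous_const.add uniformContinuous_subtype_val)))
    ⟨‖y‖, fun _ => y.norm_coe_le_norm _⟩

theorem segment_apply (hη : 0 ≤ η) (t : ℝ≥0) (y : BoundedContinuousFunction (Icc (0 : ℝ) t) E)
    (θ : Iic (0 : ℝ)) :
    segment hη t y θ = y (projIcc 0 (t : ℝ) t.coe_nonneg (t + θ)) := rfl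

theorem dist_segment_le (hη : 0 ≤ η) (t : ℝ≥0)
    (y z : BoundedContinuousFunction (Icc (0 : ℝ) t) E) :
    dist (segment hη t y) (segment hη t z) ≤ dist y z := by
  rw [dist_eq_norm]
  refine BUC.norm_le_of_norm_apply_le hη dist_nonneg fun θ => ?_
  rw [BUC.sub_apply, segment_apply, segment_apply, ← dist_eq_norm]
  exact BoundedContinuousFunction.dist_coe_le_dist _

theorem projIcc_eq_max (t : ℝ≥0) (θ : Iic (0 : ℝ)) :
    (projIcc 0 (t : ℝ) t.coe_nonneg (t + θ) : ℝ) = max ((t : ℝ) + θ) 0 := by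
  have h : (θ : ℝ) ≤ 0 := θ.2
  rw [coe_projIcc, max_comm, min_eq_right (by linarith)]

/-! ### The semigroup of translations, frozen at the origin -/

/-- The point `min (θ + t) 0` of `(-∞, 0]`. -/
def advance (t : ℝ≥0) (θ : Iic (0 : ℝ)) : Iic (0 : ℝ) :=
  ⟨min ((θ : ℝ) + t) 0, mem_Iic.mpr (min_le_right _ _)⟩

theorem advance_coe (t : ℝ≥0) (θ : Iic (0 : ℝ)) : (advance t θ : ℝ) = min ((θ : ℝ) + t) 0 := rfl

theorem le_advance (t : ℝ≥0) (θ : Iic (0 : ℝ)) : (θ : ℝ) ≤ advance t θ :=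
  le_min (by simp) θ.2

theorem advance_le (t : ℝ≥0) (θ : Iic (0 : ℝ)) : (advance t θ : ℝ) ≤ (θ : ℝ) + t := min_le_left _ _

theorem advance_zero (θ : Iic (0 : ℝ)) : advance 0 θ = θ := by
  ext
  rw [advance_coe, NNReal.coe_zero, add_zero]
  exact min_eq_left θ.2

theorem advance_add (s t : ℝ≥0) (θ : Iic (0 : ℝ)) :
    advance (s + t) θ = advance t (advance s θ) := by
  ext
  have h := t.coe_nonneg
  simp only [advance_coe, NNReal.coe_add]
  rcases le_total ((θ : ℝ) + s) 0 with h1 | h1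
  · rw [min_eq_left h1, add_assoc]
  · rw [min_eq_right h1, min_eq_right (by linarith), min_eq_right (by linarith)]

theorem uniformContinuous_advance (t : ℝ≥0) : UniformContinuous (advance t) := by
  have h : UniformContinuous fun θ : Iic (0 : ℝ) => min ((θ : ℝ) + t) 0 :=
    (LipschitzWith.id.min_const 0).uniformContinuous.comp
      (uniformContinuous_subtype_val.add uniformContinuous_const)
  exact h.subtype_mk _

/-- Moves the weight from `θ` to the advanced point. As `θ ≤ advance t θ`, the leftover factor is at
most one when `0 ≤ η`, whence both contractivity and uniform continuity of translations. -/
theorem smul_apply_advance (φ : BUC η E) (t : ℝ≥0) (θ : Iic (0 : ℝ)) :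
    Real.exp (η * θ) • φ (advance t θ) =
      Real.exp (η * (θ - advance t θ)) • weighted η E φ (advance t θ) := by
  rw [weighted_apply, smul_smul, ← Real.exp_add]
  ring_nf

theorem exp_mul_sub_advance_le_one (hη : 0 ≤ η) (t : ℝ≥0) (θ : Iic (0 : ℝ)) :
    Real.exp (η * (θ - advance t θ)) ≤ 1 :=
  Real.exp_le_one_iff.2 (mul_nonpos_of_nonneg_of_nonpos hη (sub_nonpos.2 (le_advance t θ)))

theorem exp_mul_norm_apply_advance_le (hη : 0 ≤ η) (φ : BUC η E) (t : ℝ≥0) (θ : Iic (0 : ℝ)) :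
    Real.exp (η * θ) * ‖φ (advance t θ)‖ ≤ ‖φ‖ := by
  rw [← Real.norm_of_nonneg (Real.exp_pos (η * θ)).le, ← norm_smul, smul_apply_advance, norm_smul,
    Real.norm_of_nonneg (Real.exp_pos _).le]
  exact (mul_le_of_le_one_left (norm_nonneg _) (exp_mul_sub_advance_le_one hη t θ)).trans
    ((weighted η E φ).norm_coe_le_norm _)

/-- The operator `φ ↦ (θ ↦ φ(min (θ + t) 0))`. -/
def translation (hη : 0 ≤ η) (t : ℝ≥0) : BUC η E →L[ℝ] BUC η E :=
  LinearMap.mkContinuous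
    { toFun := fun φ => ⟨⟨fun θ => φ (advance t θ),
        φ.continuous_coe.comp (uniformContinuous_advance t).continuous⟩,
        ⟨‖φ‖, fun θ => by
          rw [norm_smul, Real.norm_of_nonneg (Real.exp_pos _).le]
          exact exp_mul_norm_apply_advance_le hη φ t θ⟩, by
          simp only [ContinuousMap.coe_mk, smul_apply_advance]
          refine uniformContinuous_smul_of_bounded (A := 1) (B := ‖φ‖) ?_ ?_ ?_ ?_
          · refine uniformContinuous_exp_comp (UniformContinuous.const_mul' ?_ η) fun θ => ?_
            · exact uniformContinuous_subtype_val.sub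
                (uniformContinuous_subtype_val.comp (uniformContinuous_advance t))
            · exact mul_nonpos_of_nonneg_of_nonpos hη (sub_nonpos.2 (le_advance t θ))
          · exact UniformContinuous.comp φ.2.2 (uniformContinuous_advance t)
          · intro θ
            rw [Real.norm_of_nonneg (Real.exp_pos _).le]
            exact exp_mul_sub_advance_le_one hη t θ
          · exact fun θ => (weighted η E φ).norm_coe_le_norm _⟩
      map_add' := fun _ _ => rfl
      map_smul' := fun _ _ => rfl } 1 fun φ => by
    rw [one_mul]
    exact BUC.norm_le (norm_nonneg _) (exp_mul_norm_apply_advance_le hη φ t)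

theorem translation_apply (hη : 0 ≤ η) (t : ℝ≥0) (φ : BUC η E) (θ : Iic (0 : ℝ)) :
    translation hη t φ θ = φ (advance t θ) := rfl

theorem norm_translation_apply_le (hη : 0 ≤ η) (t : ℝ≥0) (φ : BUC η E) :
    ‖translation hη t φ‖ ≤ ‖φ‖ :=
  BUC.norm_le (norm_nonneg _) (exp_mul_norm_apply_advance_le hη φ t)

theorem translation_zero (hη : 0 ≤ η) (φ : BUC η E) : translation hη 0 φ = φ :=
  BUC.ext fun θ => by rw [translation_apply, advance_zero]

theorem translation_add (hη : 0 ≤ η) (s t : ℝ≥0) (φ : BUC η E) :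
    translation hη (s + t) φ = translation hη s (translation hη t φ) :=
  BUC.ext fun θ => by rw [translation_apply, translation_apply, translation_apply, advance_add]

theorem tendsto_translation (hη : 0 ≤ η) (φ : BUC η E) :
    Tendsto (fun t => translation hη t φ) (𝓝 0) (𝓝 φ) := by
  rw [Metric.tendsto_nhds]
  intro ε hε
  obtain ⟨δ, hδ, hφ⟩ := Metric.uniformContinuous_iff.1 φ.2.2 (ε / 3) (by linarith)
  have h1 : ∀ᶠ t : ℝ≥0 in 𝓝 0, (t : ℝ) < δ :=
    NNReal.continuous_coe.tendsto 0 |>.eventually (gt_mem_nhds (by simpa using hδ))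
  have h2 : ∀ᶠ t : ℝ≥0 in 𝓝 0, η * t * ‖φ‖ < ε / 3 := by
    have hc : Continuous fun t : ℝ≥0 => η * t * ‖φ‖ := by fun_prop
    exact (hc.tendsto 0).eventually (gt_mem_nhds (by simp; linarith))
  filter_upwards [h1, h2] with t ht1 ht2
  refine lt_of_le_of_lt ?_ (show 2 * ε / 3 < ε by linarith)
  rw [dist_eq_norm]
  refine BUC.norm_le (by linarith) fun θ => ?_
  have hle := le_advance t θ
  have hle' := advance_le t θ
  rw [← Real.norm_of_nonneg (Real.exp_pos (η * θ)).le, ← norm_smul, BUC.sub_apply,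
    translation_apply, smul_sub, smul_apply_advance, ← weighted_apply]
  -- The first term is the change of weight, of size at most `η t ‖φ‖`; the second is governed by
  -- the modulus of continuity of the weighted function.
  have e : Real.exp (η * (θ - advance t θ)) • weighted η E φ (advance t θ) - weighted η E φ θ
      = (Real.exp (η * (θ - advance t θ)) - Real.exp 0) • weighted η E φ (advance t θ)
        + (weighted η E φ (advance t θ) - weighted η E φ θ) := by
    rw [sub_smul, Real.exp_zero, one_smul]; abel
  rw [e]
  have b1 : ‖weighted η E φ (advance t θ) - weighted η E φ θ‖ < ε / 3 := by
    rw [← dist_eq_norm]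
    refine hφ (?_ : dist (advance t θ) θ < δ)
    rw [Subtype.dist_eq, Real.dist_eq, abs_of_nonneg (sub_nonneg.2 hle)]
    linarith
  have b2 : ‖(Real.exp (η * (θ - advance t θ)) - Real.exp 0) • weighted η E φ (advance t θ)‖
      ≤ η * t * ‖φ‖ := by
    rw [norm_smul]
    refine mul_le_mul ?_ ((weighted η E φ).norm_coe_le_norm _) (norm_nonneg _) (by positivity)
    refine (abs_exp_sub_exp_le ?_ le_rfl).trans ?_
    · exact mul_nonpos_of_nonneg_of_nonpos hη (sub_nonpos.2 hle)
    · rw [sub_zero, abs_mul, abs_of_nonneg hη, abs_of_nonpos (sub_nonpos.2 hle)]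
      gcongr
      linarith
  linarith [norm_add_le ((Real.exp (η * (θ - advance t θ)) - Real.exp 0) •
    weighted η E φ (advance t θ)) (weighted η E φ (advance t θ) - weighted η E φ θ)]

theorem continuous_translation (hη : 0 ≤ η) (φ : BUC η E) :
    Continuous fun t => translation hη t φ := by
  rw [continuous_iff_continuousAt]
  intro s
  -- The semigroup law and contractivity reduce continuity at `s`, from both sides, to continuity at
  -- `0`.
  have key : ∀ s t : ℝ≥0, ‖translation hη t φ - translation hη s φ‖
      ≤ ‖translation hη (max s t - min s t) φ - φ‖ := by
    intro s t
    wlog h : s ≤ t generalizing s t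
    · rw [norm_sub_rev, max_comm, min_comm]
      exact this t s (le_of_not_ge h)
    rw [max_eq_right h, min_eq_left h]
    have e : translation hη t φ - translation hη s φ
        = translation hη s (translation hη (t - s) φ - φ) := by
      rw [map_sub, ← translation_add, add_tsub_cancel_of_le h]
    rw [e]
    exact norm_translation_apply_le hη _ _
  refine tendsto_iff_norm_sub_tendsto_zero.2 (squeeze_zero (fun _ => norm_nonneg _) (key s) ?_)
  have h1 : Tendsto (fun t : ℝ≥0 => max s t - min s t) (𝓝 s) (𝓝 0) := by
    have hc : Continuous fun t : ℝ≥0 => max s t - min s t := by fun_prop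
    simpa using hc.tendsto s
  have h2 := ((tendsto_translation hη φ).comp h1).sub_const φ |>.norm
  simpa using h2

end Space

section Space

variable {η : ℝ} {E : Type*} [NormedAddCommGroup E] [NormedSpace ℝ E]

/-! ### Primitives of exponentially bounded functions -/

/-- The function `r ↦ exp (a r) f(r)`, where `f` is extended by `f(0)` to negative `r`. -/
def unweight (a : ℝ) (f : ℝ≥0 →ᵇ E) (r : ℝ) : E := Real.exp (a * r) • f r.toNNReal

theorem continuous_unweight (a : ℝ) (f : ℝ≥0 →ᵇ E) : Continuous (unweight a f) := by
  have h : Continuous fun r : ℝ => f r.toNNReal := f.continuous.comp continuous_real_toNNReal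
  unfold unweight
  fun_prop

theorem unweight_zero (a : ℝ) (f : ℝ≥0 →ᵇ E) : unweight a f 0 = f 0 := by simp [unweight]

theorem norm_unweight_le (a : ℝ) (f : ℝ≥0 →ᵇ E) (r : ℝ) :
    ‖unweight a f r‖ ≤ ‖f‖ * Real.exp (a * r) := by
  rw [unweight, norm_smul, Real.norm_of_nonneg (Real.exp_pos _).le, mul_comm]
  gcongr
  exact f.norm_coe_le_norm _

/-- The primitive of `r ↦ exp (a r) f(r)` vanishing at `0`. -/
def primitive (a : ℝ) (f : ℝ≥0 →ᵇ E) (s : ℝ) : E := ∫ r in (0 : ℝ)..s, unweight a f r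

theorem primitive_zero (a : ℝ) (f : ℝ≥0 →ᵇ E) : primitive a f 0 = 0 := by simp [primitive]

theorem primitive_add (a : ℝ) (f g : ℝ≥0 →ᵇ E) (s : ℝ) :
    primitive a (f + g) s = primitive a f s + primitive a g s := by
  rw [primitive, primitive, primitive, ← intervalIntegral.integral_add
    ((continuous_unweight a f).intervalIntegrable _ _)
    ((continuous_unweight a g).intervalIntegrable _ _)]
  simp [unweight]

theorem primitive_smul (a c : ℝ) (f : ℝ≥0 →ᵇ E) (s : ℝ) :
    primitive a (c • f) s = c • primitive a f s := by
  rw [primitive, primitive, ← intervalIntegral.integral_smul]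
  simp only [unweight, BoundedContinuousFunction.coe_smul, smul_comm c]

theorem hasDerivAt_primitive [CompleteSpace E] (a : ℝ) (f : ℝ≥0 →ᵇ E) (s : ℝ) :
    HasDerivAt (primitive a f) (unweight a f s) s :=
  ((continuous_unweight a f).integral_hasStrictDerivAt 0 s).hasDerivAt

theorem norm_primitive_sub_le {a b : ℝ} (ha : 0 ≤ a) (f : ℝ≥0 →ᵇ E) {s s' : ℝ} (hs : s ≤ b)
    (hs' : s' ≤ b) :
    ‖primitive a f s - primitive a f s'‖ ≤ ‖f‖ * Real.exp (a * b) * |s - s'| := by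
  rw [primitive, primitive, intervalIntegral.integral_interval_sub_left
    ((continuous_unweight a f).intervalIntegrable _ _)
    ((continuous_unweight a f).intervalIntegrable _ _)]
  refine intervalIntegral.norm_integral_le_of_norm_le_const fun r hr => ?_
  refine (norm_unweight_le a f r).trans ?_
  have : r ≤ b := hr.2.trans (max_le hs' hs)
  gcongr

theorem norm_primitive_le {a : ℝ} (ha : 0 < a) (f : ℝ≥0 →ᵇ E) {s : ℝ} (hs : 0 ≤ s) :
    ‖primitive a f s‖ ≤ ‖f‖ * Real.exp (a * s) / a := by
  have h1 : ∀ x ∈ uIcc (0 : ℝ) s,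
      HasDerivAt (fun x : ℝ => ‖f‖ * Real.exp (a * x) / a) (‖f‖ * Real.exp (a * x)) x := by
    intro x _
    have h2 := (((hasDerivAt_id x).const_mul a).exp.const_mul ‖f‖).div_const a
    refine h2.congr_deriv ?_
    rw [id, mul_one, ← mul_assoc, mul_div_cancel_right₀ _ ha.ne']
  have hc : Continuous fun x : ℝ => ‖f‖ * Real.exp (a * x) := by fun_prop
  have h2 := intervalIntegral.integral_eq_sub_of_hasDerivAt h1 (hc.intervalIntegrable _ _)
  have h3 : ‖primitive a f s‖ ≤ ∫ r in (0 : ℝ)..s, ‖f‖ * Real.exp (a * r) :=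
    intervalIntegral.norm_integral_le_of_norm_le hs
      (MeasureTheory.ae_of_all _ fun r _ => norm_unweight_le a f r) (hc.intervalIntegrable _ _)
  rw [h2] at h3
  have : 0 ≤ ‖f‖ * Real.exp (a * 0) / a := by positivity
  linarith

theorem continuous_primitive {a : ℝ} (ha : 0 ≤ a) (f : ℝ≥0 →ᵇ E) :
    Continuous (primitive a f) := by
  rw [continuous_iff_continuousAt]
  intro s
  have h : LipschitzOnWith (Real.toNNReal (‖f‖ * Real.exp (a * (s + 1)))) (primitive a f)
      (Iic (s + 1)) := by
    refine LipschitzOnWith.of_dist_le_mul fun x hx y hy => ?_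
    rw [Real.coe_toNNReal _ (by positivity), dist_eq_norm, Real.dist_eq]
    exact norm_primitive_sub_le ha f hx hy
  exact h.continuousOn.continuousAt (Iic_mem_nhds (by linarith))

/-- The function `r ↦ exp (a s) f(s + r)`. -/
def shiftForward (a : ℝ) (s : ℝ≥0) (f : ℝ≥0 →ᵇ E) : ℝ≥0 →ᵇ E :=
  Real.exp (a * s) • f.compContinuous ⟨fun r => s + r, by fun_prop⟩

theorem shiftForward_apply (a : ℝ) (s : ℝ≥0) (f : ℝ≥0 →ᵇ E) (r : ℝ≥0) :
    shiftForward a s f r = Real.exp (a * s) • f (s + r) := rfl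

theorem unweight_shiftForward (a : ℝ) (s : ℝ≥0) (f : ℝ≥0 →ᵇ E) {r : ℝ} (hr : 0 ≤ r) :
    unweight a (shiftForward a s f) r = unweight a f (s + r) := by
  rw [unweight, unweight, shiftForward_apply, smul_smul, ← Real.exp_add,
    Real.toNNReal_add s.coe_nonneg hr, Real.toNNReal_coe]
  ring_nf

theorem primitive_add_right (a : ℝ) (f : ℝ≥0 →ᵇ E) (s : ℝ≥0) {r : ℝ} (hr : 0 ≤ r) :
    primitive a f (s + r) = primitive a f s + primitive a (shiftForward a s f) r := by
  have hi := fun x y => (continuous_unweight a f).intervalIntegrable (μ := MeasureTheory.volume) x y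
  have h1 : primitive a (shiftForward a s f) r = ∫ x in (0 : ℝ)..r, unweight a f (s + x) := by
    refine intervalIntegral.integral_congr fun x hx => ?_
    rw [uIcc_of_le hr] at hx
    exact unweight_shiftForward a s f hx.1
  rw [h1, intervalIntegral.integral_comp_add_left (fun x => unweight a f x), add_zero, primitive,
    primitive, intervalIntegral.integral_add_adjacent_intervals (hi _ _) (hi _ _)]

/-! ### The contribution of the delay term -/

theorem norm_segment_primitive_le (hη : 0 ≤ η) {a : ℝ} (ha : 0 < a) (t : ℝ≥0)
    (f : ℝ≥0 →ᵇ E) :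
    ‖segment hη t (BoundedContinuousFunction.mkOfCompact
        ⟨fun s => primitive a f s, (continuous_primitive ha.le f).comp continuous_subtype_val⟩)‖
      ≤ Real.exp (a * t) / a * ‖f‖ := by
  refine BUC.norm_le_of_norm_apply_le hη (by positivity) fun θ => ?_
  refine (norm_primitive_le ha f (projIcc 0 (t : ℝ) t.coe_nonneg (t + θ)).2.1).trans ?_
  have h := (projIcc 0 (t : ℝ) t.coe_nonneg (t + θ)).2.2
  rw [mul_div_assoc, mul_comm]
  gcongr

/-- The function `θ ↦ ∫₀^{(t + θ)⁺} exp (a r) f(r) dr` in `BUC_η`, as an operator in `f`. -/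
def duhamel (hη : 0 ≤ η) {a : ℝ} (ha : 0 < a) (t : ℝ≥0) : (ℝ≥0 →ᵇ E) →L[ℝ] BUC η E :=
  LinearMap.mkContinuous
    { toFun := fun f => segment hη t (BoundedContinuousFunction.mkOfCompact
        ⟨fun s => primitive a f s, (continuous_primitive ha.le f).comp continuous_subtype_val⟩)
      map_add' := fun f g => BUC.ext fun _ => primitive_add a f g _
      map_smul' := fun c f => BUC.ext fun _ => primitive_smul a c f _ }
    (Real.exp (a * t) / a) (norm_segment_primitive_le hη ha t)

theorem duhamel_apply (hη : 0 ≤ η) {a : ℝ} (ha : 0 < a) (t : ℝ≥0) (f : ℝ≥0 →ᵇ E)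
    (θ : Iic (0 : ℝ)) : duhamel hη ha t f θ = primitive a f (max ((t : ℝ) + θ) 0) := by
  rw [← projIcc_eq_max]
  rfl

theorem norm_duhamel_apply_le (hη : 0 ≤ η) {a : ℝ} (ha : 0 < a) (t : ℝ≥0) (f : ℝ≥0 →ᵇ E) :
    ‖duhamel hη ha t f‖ ≤ Real.exp (a * t) / a * ‖f‖ :=
  norm_segment_primitive_le hη ha t f

theorem duhamel_zero (hη : 0 ≤ η) {a : ℝ} (ha : 0 < a) (f : ℝ≥0 →ᵇ E) :
    duhamel hη ha 0 f = 0 := by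
  refine BUC.ext fun θ => ?_
  have h : (θ : ℝ) ≤ 0 := θ.2
  rw [duhamel_apply, NNReal.coe_zero, zero_add, max_eq_right h, primitive_zero]
  rfl

theorem continuous_duhamel (hη : 0 ≤ η) {a : ℝ} (ha : 0 < a) (f : ℝ≥0 →ᵇ E) :
    Continuous fun t => duhamel hη ha t f := by
  rw [continuous_iff_continuousAt]
  intro s
  have h : LipschitzOnWith (Real.toNNReal (‖f‖ * Real.exp (a * (s + 1))))
      (fun t => duhamel hη ha t f) (Iic (s + 1)) := by
    refine LipschitzOnWith.of_dist_le_mul fun x hx y hy => ?_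
    rw [Real.coe_toNNReal _ (by positivity), dist_eq_norm, NNReal.dist_eq]
    refine BUC.norm_le_of_norm_apply_le hη (by positivity) fun θ => ?_
    have hθ : (θ : ℝ) ≤ 0 := θ.2
    have hx' : (x : ℝ) ≤ (s + 1 : ℝ≥0) := NNReal.coe_le_coe.2 hx
    rw [NNReal.coe_add, NNReal.coe_one] at hx'
    have hy' : (y : ℝ) ≤ (s + 1 : ℝ≥0) := NNReal.coe_le_coe.2 hy
    rw [NNReal.coe_add, NNReal.coe_one] at hy'
    have hs := s.coe_nonneg
    rw [BUC.sub_apply, duhamel_apply, duhamel_apply]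
    refine (norm_primitive_sub_le ha.le f (b := (s : ℝ) + 1) (max_le (by linarith) (by linarith))
      (max_le (by linarith) (by linarith))).trans ?_
    refine mul_le_mul_of_nonneg_left ?_ (by positivity)
    have h := abs_max_sub_max_le_abs ((x : ℝ) + θ) ((y : ℝ) + θ) 0
    rwa [add_sub_add_right_eq_sub] at h
  have hlt : s < s + 1 := by simp
  exact h.continuousOn.continuousAt (Iic_mem_nhds hlt)

/-- The integral is cut at time `s`: the part before `s` is transported by translation, the part
after it restarts with the shifted density. This is the cocycle identity behind the semigroup law.
-/
theorem duhamel_add (hη : 0 ≤ η) {a : ℝ} (ha : 0 < a) (s t : ℝ≥0) (f : ℝ≥0 →ᵇ E) :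
    duhamel hη ha (s + t) f = translation hη t (duhamel hη ha s f)
      + duhamel hη ha t (shiftForward a s f) := by
  refine BUC.ext fun θ => ?_
  have hs := s.coe_nonneg
  rw [BUC.add_apply, translation_apply, duhamel_apply, duhamel_apply, duhamel_apply, advance_coe]
  push_cast
  rcases le_total ((θ : ℝ) + t) 0 with h | h
  · rw [max_eq_right (show (t : ℝ) + θ ≤ 0 by linarith), primitive_zero, add_zero, min_eq_left h]
    congr 2
    ring
  · rw [max_eq_left (show 0 ≤ (t : ℝ) + θ by linarith), min_eq_right h, add_zero, max_eq_left hs,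
      ← primitive_add_right a f s (show 0 ≤ (t : ℝ) + θ by linarith),
      max_eq_left (show 0 ≤ (s : ℝ) + t + θ by linarith), add_assoc]

/-! ### The renewal equation and the solution semigroup -/

variable (hη : 0 ≤ η) (L : BUC η E →L[ℝ] E)

/-- The exponential rate with respect to which the renewal equation is a contraction. -/
def rate : ℝ := ‖L‖ + 1

theorem rate_pos : 0 < rate L := by have := norm_nonneg L; unfold rate; linarith

theorem exp_neg_rate_le_one (t : ℝ≥0) : Real.exp (-(rate L * t)) ≤ 1 := by
  rw [Real.exp_le_one_iff]
  have := mul_nonneg (rate_pos L).le t.coe_nonneg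
  linarith

theorem norm_forcing_le (φ : BUC η E) (t : ℝ≥0) :
    ‖Real.exp (-(rate L * t)) • L (translation hη t φ)‖ ≤ ‖L‖ * ‖φ‖ := by
  rw [norm_smul, Real.norm_of_nonneg (Real.exp_pos _).le]
  refine (mul_le_of_le_one_left (norm_nonneg _) (exp_neg_rate_le_one L t)).trans ?_
  refine (L.le_opNorm _).trans ?_
  gcongr
  exact norm_translation_apply_le hη t φ

/-- The forcing term `t ↦ exp (-a t) L (S(t) φ)` of the renewal equation. -/
def forcing : BUC η E →L[ℝ] ℝ≥0 →ᵇ E :=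
  LinearMap.mkContinuous
    { toFun := fun φ => BoundedContinuousFunction.ofNormedAddCommGroup
        (fun t : ℝ≥0 => Real.exp (-(rate L * t)) • L (translation hη t φ))
        (by have := continuous_translation hη φ; fun_prop) (‖L‖ * ‖φ‖)
        (norm_forcing_le hη L φ)
      map_add' := fun φ ψ => by
        ext t
        simp
      map_smul' := fun c φ => by
        ext t
        simp [smul_comm c] } ‖L‖ fun φ =>
    BoundedContinuousFunction.norm_ofNormedAddCommGroup_le _ (by positivity)
      (norm_forcing_le hη L φ)

theorem forcing_apply (φ : BUC η E) (t : ℝ≥0) :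
    forcing hη L φ t = Real.exp (-(rate L * t)) • L (translation hη t φ) := rfl

/-- The weight cancels the growth `exp (a t) / a` of the Duhamel term and leaves the factor `‖L‖ /
a`, which is below one for `a = ‖L‖ + 1`. -/
theorem norm_renewal_le (f : ℝ≥0 →ᵇ E) (t : ℝ≥0) :
    ‖Real.exp (-(rate L * t)) • L (duhamel hη (rate_pos L) t f)‖ ≤ ‖L‖ / rate L * ‖f‖ := by
  rw [norm_smul, Real.norm_of_nonneg (Real.exp_pos _).le]
  have h := (L.le_opNorm _).trans (mul_le_mul_of_nonneg_left
    (norm_duhamel_apply_le hη (rate_pos L) t f) (norm_nonneg L))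
  refine (mul_le_mul_of_nonneg_left h (Real.exp_pos _).le).trans (le_of_eq ?_)
  rw [Real.exp_neg]
  have := (Real.exp_pos (rate L * t)).ne'
  field_simp

/-- The operator of the renewal equation. -/
def renewal : (ℝ≥0 →ᵇ E) →L[ℝ] ℝ≥0 →ᵇ E :=
  LinearMap.mkContinuous
    { toFun := fun f => BoundedContinuousFunction.ofNormedAddCommGroup
        (fun t : ℝ≥0 => Real.exp (-(rate L * t)) • L (duhamel hη (rate_pos L) t f))
        (by have := continuous_duhamel hη (rate_pos L) f; fun_prop) (‖L‖ / rate L * ‖f‖)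
        (norm_renewal_le hη L f)
      map_add' := fun f g => by
        ext t
        simp
      map_smul' := fun c f => by
        ext t
        simp [smul_comm c] } (‖L‖ / rate L) fun f =>
    BoundedContinuousFunction.norm_ofNormedAddCommGroup_le _
      (mul_nonneg (div_nonneg (norm_nonneg _) (rate_pos L).le) (norm_nonneg _))
      (norm_renewal_le hη L f)

theorem renewal_apply (f : ℝ≥0 →ᵇ E) (t : ℝ≥0) :
    renewal hη L f t = Real.exp (-(rate L * t)) • L (duhamel hη (rate_pos L) t f) := rfl

theorem norm_renewal_lt_one : ‖renewal hη L‖ < 1 := by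
  refine (LinearMap.mkContinuous_norm_le _ (div_nonneg (norm_nonneg _) (rate_pos L).le) _).trans_lt
    ?_
  rw [div_lt_one (rate_pos L)]
  unfold rate
  linarith

variable [CompleteSpace E]

/-- The solution operator of the renewal equation. -/
def resolvent : BUC η E →L[ℝ] ℝ≥0 →ᵇ E :=
  ((Units.oneSub (renewal hη L) (norm_renewal_lt_one hη L))⁻¹.val).comp (forcing hη L)

theorem resolvent_eq (φ : BUC η E) :
    resolvent hη L φ = forcing hη L φ + renewal hη L (resolvent hη L φ) := by
  have h := (Units.oneSub (renewal hη L) (norm_renewal_lt_one hη L)).mul_inv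
  have h' : resolvent hη L φ - renewal hη L (resolvent hη L φ) = forcing hη L φ :=
    congrArg (fun A : (ℝ≥0 →ᵇ E) →L[ℝ] ℝ≥0 →ᵇ E => A (forcing hη L φ)) h
  exact sub_eq_iff_eq_add.1 h'

theorem eq_resolvent {f : ℝ≥0 →ᵇ E} {φ : BUC η E} (h : f = forcing hη L φ + renewal hη L f) :
    f = resolvent hη L φ := by
  have h1 := (Units.oneSub (renewal hη L) (norm_renewal_lt_one hη L)).inv_mul
  have h' : (Units.oneSub (renewal hη L) (norm_renewal_lt_one hη L))⁻¹.val (f - renewal hη L f)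
      = f := congrArg (fun A : (ℝ≥0 →ᵇ E) →L[ℝ] ℝ≥0 →ᵇ E => A f) h1
  rw [sub_eq_iff_eq_add.2 h] at h'
  exact h'.symm

/-- The history at time `t` of the solution of `x' = L xₜ` with initial history `φ`. -/
def solution (t : ℝ≥0) : BUC η E →L[ℝ] BUC η E :=
  translation hη t + (duhamel hη (rate_pos L) t).comp (resolvent hη L)

theorem solution_apply (t : ℝ≥0) (φ : BUC η E) :
    solution hη L t φ = translation hη t φ + duhamel hη (rate_pos L) t (resolvent hη L φ) := rfl

/-- This is the renewal equation read as the delay equation: without its weight, the density at time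
`t` is `L` of the current history. -/
theorem resolvent_apply (φ : BUC η E) (t : ℝ≥0) :
    resolvent hη L φ t = Real.exp (-(rate L * t)) • L (solution hη L t φ) := by
  rw [resolvent_eq, BoundedContinuousFunction.add_apply, forcing_apply, renewal_apply, ← smul_add,
    ← map_add]
  rfl

theorem solution_zero (φ : BUC η E) : solution hη L 0 φ = φ := by
  rw [solution_apply, translation_zero, duhamel_zero, add_zero]

theorem resolvent_zero (φ : BUC η E) : resolvent hη L φ 0 = L φ := by
  rw [resolvent_apply, solution_zero]
  simp

/-- By `duhamel_add`, the shifted density solves the renewal equation started from the history at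
time `s`; uniqueness does the rest. -/
theorem resolvent_solution (s : ℝ≥0) (φ : BUC η E) :
    resolvent hη L (solution hη L s φ) = shiftForward (rate L) s (resolvent hη L φ) := by
  symm
  refine eq_resolvent hη L ?_
  ext t
  rw [BoundedContinuousFunction.add_apply, forcing_apply, renewal_apply, ← smul_add, ← map_add,
    shiftForward_apply, resolvent_apply, smul_smul, ← Real.exp_add, solution_apply,
    solution_apply, duhamel_add, add_comm s t, translation_add, map_add (translation hη t),
    add_assoc]
  congr 2
  push_cast
  ring

theorem solution_add (s t : ℝ≥0) (φ : BUC η E) :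
    solution hη L (s + t) φ = solution hη L s (solution hη L t φ) := by
  rw [solution_apply hη L s, resolvent_solution, solution_apply, solution_apply,
    translation_add, map_add (translation hη s), add_assoc, ← duhamel_add, add_comm s t]

/-- The semigroup of the delay equation `x' = L xₜ` on `BUC_η`. -/
def solutionSemigroup : C0Semigroup (BUC η E) where
  toFun := solution hη L
  map_zero := ContinuousLinearMap.ext (solution_zero hη L)
  map_add s t := ContinuousLinearMap.ext (solution_add hη L s t)
  continuous φ := (continuous_translation hη φ).add
    (continuous_duhamel hη (rate_pos L) (resolvent hη L φ))

end Space

section Generator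

variable {η : ℝ} {E : Type*} [NormedAddCommGroup E] [NormedSpace ℝ E]

/-! ### The generator of the solution semigroup -/

theorem apply_advance (φ : BUC η E) (t : ℝ≥0) (θ : Iic (0 : ℝ)) :
    φ (advance t θ) = IicExtend φ ((θ : ℝ) + t) := by
  rw [IicExtend_apply]
  congr 1
  exact Subtype.ext (min_comm _ _)

theorem BUC.continuous_IicExtend (φ : BUC η E) : Continuous (IicExtend φ) := by
  have h : IicExtend φ = fun x : ℝ => φ ⟨min 0 x, mem_Iic.mpr (min_le_left _ _)⟩ := by
    funext x
    exact IicExtend_apply _ x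
  rw [h]
  exact φ.continuous_coe.comp (by fun_prop)

theorem BUC.IicExtend_of_nonneg (φ : BUC η E) {s : ℝ} (hs : 0 ≤ s) :
    IicExtend φ s = φ origin := by
  rw [IicExtend_apply]
  congr 1
  exact Subtype.ext (min_eq_left hs)

/-- Since `ψ` is continuous, right derivatives suffice to write `φ` as a primitive of `ψ`, up to and
including the endpoint `0`; a primitive has genuine derivatives. -/
theorem isDerivative_of_right [CompleteSpace E] {φ ψ : BUC η E}
    (h : ∀ θ : Iic (0 : ℝ), (θ : ℝ) < 0 →
      HasDerivWithinAt (IicExtend φ) (ψ θ) (Ici (θ : ℝ)) θ) : IsDerivative φ ψ := by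
  intro θ
  have hψ := ψ.continuous_IicExtend
  -- Any base point strictly left of `θ` works: the formula must hold on a neighbourhood of `θ` in
  -- `(-∞, 0]`.
  set c : ℝ := θ - 1 with hc
  have hθ : (θ : ℝ) ≤ 0 := θ.2
  have key : ∀ s ∈ Icc c 0, IicExtend φ s = (∫ r in c..s, IicExtend ψ r) + IicExtend φ c := by
    intro s hs
    rw [intervalIntegral.integral_eq_sub_of_hasDeriv_right_of_le hs.1
      φ.continuous_IicExtend.continuousOn (fun x hx => ?_) (hψ.intervalIntegrable _ _)]
    · abel
    · have hx0 : x < 0 := hx.2.trans_le hs.2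
      have hx' := h ⟨x, mem_Iic.mpr hx0.le⟩ hx0
      have e : IicExtend ψ x = ψ ⟨x, mem_Iic.mpr hx0.le⟩ := IicExtend_of_mem _ _
      rw [e]
      exact hx'.mono Ioi_subset_Ici_self
  have hd : HasDerivAt (fun s => (∫ r in c..s, IicExtend ψ r) + IicExtend φ c) (ψ θ) θ := by
    have e : IicExtend ψ (θ : ℝ) = ψ θ := IicExtend_coe _ _
    rw [← e]
    exact ((hψ.integral_hasStrictDerivAt c θ).hasDerivAt).add_const _
  refine (hd.hasDerivWithinAt (s := Iic 0)).congr_of_eventuallyEq ?_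
    (key θ ⟨by linarith, hθ⟩)
  have hnear : ∀ᶠ s in 𝓝[Iic 0] (θ : ℝ), c < s :=
    nhdsWithin_le_nhds (Ioi_mem_nhds (by linarith))
  filter_upwards [hnear, self_mem_nhdsWithin] with s h1 h2
  exact key s ⟨h1.le, h2⟩

variable [CompleteSpace E] (hη : 0 ≤ η) (L : BUC η E →L[ℝ] E)

theorem solution_apply_apply (t : ℝ≥0) (φ : BUC η E) (θ : Iic (0 : ℝ)) :
    solution hη L t φ θ = IicExtend φ ((θ : ℝ) + t)
      + primitive (rate L) (resolvent hη L φ) (max ((θ : ℝ) + t) 0) := by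
  rw [solution_apply, BUC.add_apply, translation_apply, apply_advance, duhamel_apply,
    add_comm (t : ℝ)]

/-- Norm convergence implies pointwise convergence. At `θ < 0` the integral term vanishes for small
`t`, leaving a quotient of `φ`; at the origin `φ` is frozen, leaving a quotient of the primitive,
with limit `L φ`. -/
theorem IsDerivative.of_genRel {φ ψ : BUC η E}
    (h : (solutionSemigroup hη L).GenRel φ ψ) : IsDerivative φ ψ ∧ ψ origin = L φ := by
  have hpt : ∀ θ : Iic (0 : ℝ),
      Tendsto (fun t : ℝ≥0 => (t : ℝ)⁻¹ • (solution hη L t φ θ - φ θ)) (𝓝[>] 0) (𝓝 (ψ θ)) :=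
    fun θ => BUC.tendsto_apply h θ
  constructor
  · refine isDerivative_of_right fun θ hθ => ?_
    rw [hasDerivWithinAt_Ici_iff_tendsto]
    refine (hpt θ).congr' ?_
    have hnear : ∀ᶠ t : ℝ≥0 in 𝓝[>] 0, t < (-θ : ℝ).toNNReal :=
      nhdsWithin_le_nhds (Iio_mem_nhds (Real.toNNReal_pos.2 (by linarith)))
    filter_upwards [hnear] with t ht
    have ht' : (t : ℝ) < -θ := Real.lt_toNNReal_iff_coe_lt.1 ht
    rw [solution_apply_apply, max_eq_right (by linarith), primitive_zero, add_zero,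
      IicExtend_coe (f := φ)]
  · refine tendsto_nhds_unique (hpt origin) ?_
    have h1 := hasDerivWithinAt_Ici_iff_tendsto.1
      ((hasDerivAt_primitive (rate L) (resolvent hη L φ) 0).hasDerivWithinAt (s := Ici 0))
    rw [unweight_zero, resolvent_zero] at h1
    refine h1.congr fun t => ?_
    have e : IicExtend φ (t : ℝ) = φ origin := φ.IicExtend_of_nonneg t.coe_nonneg
    rw [solution_apply_apply, zero_add (t : ℝ), max_eq_left t.coe_nonneg, e, primitive_zero,
      sub_zero, add_sub_cancel_left]

/-- Only right derivatives are claimed, because the solution may have a kink where `θ + r = 0`; that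
point belongs to the branch of the integral. -/
theorem hasDerivWithinAt_solution {φ ψ : BUC η E} (hd : IsDerivative φ ψ) (θ : Iic (0 : ℝ))
    (r : ℝ) :
    HasDerivWithinAt (fun r : ℝ => IicExtend φ ((θ : ℝ) + r)
        + primitive (rate L) (resolvent hη L φ) (max ((θ : ℝ) + r) 0))
      (if (θ : ℝ) + r < 0 then IicExtend ψ ((θ : ℝ) + r)
        else unweight (rate L) (resolvent hη L φ) ((θ : ℝ) + r)) (Ici r) r := by
  split_ifs with h
  · have h1 : HasDerivAt (IicExtend φ) (IicExtend ψ ((θ : ℝ) + r)) ((θ : ℝ) + r) := by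
      rw [IicExtend_of_mem _ (mem_Iic.mpr h.le)]
      exact (hd ⟨(θ : ℝ) + r, mem_Iic.mpr h.le⟩).hasDerivAt (Iic_mem_nhds h)
    have h2 := (HasDerivAt.comp_const_add (θ : ℝ) r h1).hasDerivWithinAt (s := Ici r)
    refine h2.congr_of_eventuallyEq ?_ ?_
    · have hc : Continuous fun r : ℝ => (θ : ℝ) + r := by fun_prop
      have hnear : ∀ᶠ s in 𝓝[Ici r] r, (θ : ℝ) + s < 0 :=
        nhdsWithin_le_nhds ((hc.tendsto r).eventually (gt_mem_nhds h))
      filter_upwards [hnear] with s hs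
      rw [max_eq_right hs.le, primitive_zero, add_zero]
    · rw [max_eq_right h.le, primitive_zero, add_zero]
  · have h' : 0 ≤ (θ : ℝ) + r := not_lt.1 h
    have h2 : HasDerivAt (fun s => φ origin + primitive (rate L) (resolvent hη L φ) (θ + s))
        (unweight (rate L) (resolvent hη L φ) ((θ : ℝ) + r)) r :=
      (HasDerivAt.comp_const_add (θ : ℝ) r (hasDerivAt_primitive _ _ _)).const_add _
    have e : ∀ s : ℝ, r ≤ s → IicExtend φ ((θ : ℝ) + s)
        + primitive (rate L) (resolvent hη L φ) (max ((θ : ℝ) + s) 0)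
        = φ origin + primitive (rate L) (resolvent hη L φ) (θ + s) := by
      intro s hs
      have hs' : 0 ≤ (θ : ℝ) + s := by linarith
      have e1 : IicExtend φ ((θ : ℝ) + s) = φ origin := φ.IicExtend_of_nonneg hs'
      rw [max_eq_left hs', e1]
    exact (h2.hasDerivWithinAt (s := Ici r)).congr (fun s hs => e s hs) (e r le_rfl)

/-- The quotients must converge uniformly in `θ` for the weighted norm. The mean value inequality in
time, at fixed `θ`, reduces this to closeness of the time derivative to `ψ θ`; the boundary
condition makes the density start at `ψ(0)`. -/
theorem IsDerivative.genRel {φ ψ : BUC η E} (hd : IsDerivative φ ψ) (h0 : ψ origin = L φ) :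
    (solutionSemigroup hη L).GenRel φ ψ := by
  set f := resolvent hη L φ with hf
  refine Metric.tendsto_nhds.2 fun ε hε => ?_
  have hz0 : unweight (rate L) f 0 = ψ origin := by rw [unweight_zero, hf, resolvent_zero, h0]
  have h1 : ∀ᶠ r : ℝ≥0 in 𝓝 0, ‖translation hη r ψ - ψ‖ < ε / 4 := by
    have := (tendsto_translation hη ψ).eventually (Metric.ball_mem_nhds ψ (by linarith : 0 < ε / 4))
    simpa [dist_eq_norm] using this
  have h2 : ∀ᶠ r : ℝ≥0 in 𝓝 0, ‖unweight (rate L) f r - ψ origin‖ < ε / 4 := by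
    have hc : Continuous fun r : ℝ≥0 => unweight (rate L) f r :=
      (continuous_unweight _ f).comp NNReal.continuous_coe
    have := (hc.tendsto 0).eventually (Metric.ball_mem_nhds _ (by linarith : 0 < ε / 4))
    rw [NNReal.coe_zero, hz0] at this
    simpa [dist_eq_norm] using this
  obtain ⟨δ, hδ, hball⟩ := Metric.eventually_nhds_iff.1 (h1.and h2)
  have hsmall : ∀ r : ℝ≥0, (r : ℝ) < δ → ‖translation hη r ψ - ψ‖ < ε / 4 ∧
      ‖unweight (rate L) f r - ψ origin‖ < ε / 4 := fun r hr => hball (by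
    rw [NNReal.dist_eq, NNReal.coe_zero, sub_zero, abs_of_nonneg r.coe_nonneg]; exact hr)
  have hnear : ∀ᶠ t : ℝ≥0 in 𝓝[>] 0, t < δ.toNNReal :=
    nhdsWithin_le_nhds (Iio_mem_nhds (Real.toNNReal_pos.2 hδ))
  filter_upwards [hnear, self_mem_nhdsWithin] with t htδ ht0
  have htδ' : (t : ℝ) < δ := Real.lt_toNNReal_iff_coe_lt.1 htδ
  have ht : (0 : ℝ) < t := ht0
  refine lt_of_le_of_lt ?_ (show ε / 2 < ε by linarith)
  rw [dist_eq_norm]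
  refine BUC.norm_le (by linarith) fun θ => ?_
  have hexp := Real.exp_pos (η * θ)
  have hcont : Continuous fun r : ℝ => IicExtend φ ((θ : ℝ) + r)
      + primitive (rate L) f (max ((θ : ℝ) + r) 0) := by
    have c1 := φ.continuous_IicExtend
    have c2 := continuous_primitive (rate_pos L).le f
    fun_prop
  have hmv := norm_image_sub_le_of_norm_deriv_right_le_segment (a := 0) (b := t)
    (f := fun r : ℝ => (IicExtend φ ((θ : ℝ) + r)
      + primitive (rate L) f (max ((θ : ℝ) + r) 0)) - r • ψ θ)
    -- One `ε / 4` pays for `‖S(r) ψ - ψ‖`, where `S` is translation, the other for replacing the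
    -- density by `ψ(0)` once `θ + r ≥ 0`.
    (C := (Real.exp (η * θ))⁻¹ * (ε / 2))
    (by have := hcont.continuousOn (s := Icc 0 (t : ℝ)); fun_prop)
    (fun r _ => (hasDerivWithinAt_solution hη L hd θ r).sub
      ((hasDerivAt_id r).smul_const (ψ θ)).hasDerivWithinAt)
    (fun r hr => by
      rw [inv_mul_eq_div, le_div_iff₀ hexp, mul_comm, one_smul]
      lift r to ℝ≥0 using hr.1
      have hr' := hsmall r (hr.2.trans htδ')
      have hT := (translation hη r ψ - ψ).norm_apply_le θ
      rw [BUC.sub_apply, translation_apply, apply_advance] at hT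
      split_ifs with h
      · linarith [hr'.1]
      · have hθr : 0 ≤ (θ : ℝ) + r := not_lt.1 h
        have hθ0 : (θ : ℝ) ≤ 0 := θ.2
        have e1 : IicExtend ψ ((θ : ℝ) + r) = ψ origin := ψ.IicExtend_of_nonneg hθr
        rw [e1] at hT
        have hz := (hsmall ⟨(θ : ℝ) + r, hθr⟩
          (show (θ : ℝ) + r < δ by linarith [hr.2])).2
        change ‖unweight (rate L) f ((θ : ℝ) + r) - ψ origin‖ < ε / 4 at hz
        have hz' : Real.exp (η * θ) * ‖unweight (rate L) f ((θ : ℝ) + r) - ψ origin‖ ≤ ε / 4 :=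
          (mul_le_of_le_one_left (norm_nonneg _) (exp_mul_le_one hη θ)).trans hz.le
        have htri := norm_sub_le_norm_sub_add_norm_sub (unweight (rate L) f ((θ : ℝ) + r))
          (ψ origin) (ψ θ)
        have := mul_le_mul_of_nonneg_left htri hexp.le
        rw [mul_add] at this
        linarith [hr'.1])
    t ⟨ht.le, le_rfl⟩
  have hval : (((t : ℝ)⁻¹ • ((solutionSemigroup hη L).toFun t φ - φ) - ψ : BUC η E)) θ
      = (t : ℝ)⁻¹ • ((IicExtend φ ((θ : ℝ) + t) + primitive (rate L) f (max ((θ : ℝ) + t) 0)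
        - (t : ℝ) • ψ θ) - (IicExtend φ ((θ : ℝ) + 0)
        + primitive (rate L) f (max ((θ : ℝ) + 0) 0) - (0 : ℝ) • ψ θ)) := by
    have hθ0 : (θ : ℝ) ≤ 0 := θ.2
    have e : IicExtend φ ((θ : ℝ) + 0) = φ θ := by rw [add_zero]; exact IicExtend_coe _ _
    rw [BUC.sub_apply, BUC.smul_apply, BUC.sub_apply]
    change (t : ℝ)⁻¹ • (solution hη L t φ θ - φ θ) - ψ θ = _
    rw [solution_apply_apply, e, add_zero, max_eq_right hθ0, primitive_zero, zero_smul, sub_zero,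
      add_zero, sub_right_comm, smul_sub _ _ ((t : ℝ) • ψ θ), inv_smul_smul₀ ht.ne']
  rw [hval, norm_smul, norm_inv, Real.norm_of_nonneg ht.le]
  refine (mul_le_mul_of_nonneg_left (mul_le_mul_of_nonneg_left hmv (by positivity))
    hexp.le).trans (le_of_eq ?_)
  field_simp
  ring

theorem genRel_solutionSemigroup_iff {φ ψ : BUC η E} :
    (solutionSemigroup hη L).GenRel φ ψ ↔ IsDerivative φ ψ ∧ ψ origin = L φ :=
  ⟨fun h => IsDerivative.of_genRel hη L h, fun h => h.1.genRel hη L h.2⟩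

end Generator

/-! ### Essential norms -/

section Abstract

theorem noncompactnessMeasure_le {Z : Type*} [NormedAddCommGroup Z] {S : Set Z} {ε : ℝ}
    (hε : 0 < ε) (F : Finset Z) (h : S ⊆ ⋃ c ∈ F, Metric.closedBall c ε) :
    noncompactnessMeasure S ≤ ENNReal.ofReal ε := by
  refine iInf₂_le_of_le ε.toNNReal ⟨Real.toNNReal_pos.2 hε, F, ?_⟩ le_rfl
  rwa [Real.coe_toNNReal _ hε.le]

/-- By the pigeonhole principle, two of the separated points share a ball of radius `r`, so `ε ≤ 2
r`. -/
theorem le_noncompactnessMeasure {Z : Type*} [NormedAddCommGroup Z] {S : Set Z} {ε : ℝ}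
    {u : ℕ → Z} (hu : ∀ k, u k ∈ S) (hsep : ∀ j k, j ≠ k → ε ≤ dist (u j) (u k)) :
    ENNReal.ofReal (ε / 2) ≤ noncompactnessMeasure S := by
  refine le_iInf₂ fun r hr => ?_
  obtain ⟨-, F, hF⟩ := hr
  have hc : ∀ k, ∃ c : F, u k ∈ Metric.closedBall (c : Z) r := fun k => by
    obtain ⟨c, hcF, hc⟩ := mem_iUnion₂.1 (hF (hu k))
    exact ⟨⟨c, hcF⟩, hc⟩
  choose c hc using hc
  obtain ⟨j, k, hjk, heq⟩ := Finite.exists_ne_map_eq_of_infinite c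
  have h1 := Metric.mem_closedBall.1 (hc j)
  have h2 := Metric.mem_closedBall'.1 (hc k)
  rw [heq] at h1
  have h3 := (hsep j k hjk).trans (dist_triangle (u j) (c k) (u k))
  rw [← ENNReal.ofReal_coe_nnreal]
  exact ENNReal.ofReal_le_ofReal (by linarith)

variable {Z W : Type*} [NormedAddCommGroup Z] [NormedSpace ℝ Z] [NormedAddCommGroup W]
  [NormedSpace ℝ W]

theorem essNorm_of_subsingleton [Subsingleton Z] (T : Z →L[ℝ] Z) : essNorm T = 0 := by
  refine le_antisymm (le_of_forall_gt fun b hb => ?_) zero_le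
  obtain ⟨r, hr0, hrb⟩ := ENNReal.lt_iff_exists_nnreal_btwn.1 hb
  have hr : (0 : ℝ) < r := by exact_mod_cast hr0
  refine (noncompactnessMeasure_le hr {0} fun x _ => ?_).trans_lt
    (by rwa [ENNReal.ofReal_coe_nnreal])
  simp [Subsingleton.elim x 0]

/-- The conjugate of an operator by a linear isometric equivalence. -/
def conjOp (e : Z ≃ₗᵢ[ℝ] W) (T : Z →L[ℝ] Z) : W →L[ℝ] W :=
  (e.toContinuousLinearEquiv : Z →L[ℝ] W).comp
    (T.comp (e.symm.toContinuousLinearEquiv : W →L[ℝ] Z))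

theorem conjOp_apply (e : Z ≃ₗᵢ[ℝ] W) (T : Z →L[ℝ] Z) (x : W) :
    conjOp e T x = e (T (e.symm x)) := rfl

theorem essNorm_conjOp_le (e : Z ≃ₗᵢ[ℝ] W) (T : Z →L[ℝ] Z) :
    essNorm (conjOp e T) ≤ essNorm T := by
  classical
  refine le_iInf₂ fun r hr => ?_
  obtain ⟨hr0, F, hF⟩ := hr
  rw [← ENNReal.ofReal_coe_nnreal]
  refine noncompactnessMeasure_le hr0 (F.image e) ?_
  rintro _ ⟨x, hx, rfl⟩
  have hx' : e.symm x ∈ Metric.closedBall (0 : Z) 1 := by simpa using hx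
  obtain ⟨c, hcF, hc⟩ := mem_iUnion₂.1 (hF (mem_image_of_mem T hx'))
  refine mem_iUnion₂.2 ⟨e c, Finset.mem_image_of_mem e hcF, ?_⟩
  rw [conjOp_apply, Metric.mem_closedBall, e.dist_map]
  exact hc

theorem essNorm_conjOp (e : Z ≃ₗᵢ[ℝ] W) (T : Z →L[ℝ] Z) : essNorm (conjOp e T) = essNorm T := by
  refine le_antisymm (essNorm_conjOp_le e T) ?_
  have h : conjOp e.symm (conjOp e T) = T := by
    ext x
    simp [conjOp_apply]
  conv_lhs => rw [← h]
  exact essNorm_conjOp_le e.symm _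

namespace C0Semigroup

/-- The conjugate of a semigroup by a linear isometric equivalence. -/
def conj (e : Z ≃ₗᵢ[ℝ] W) (T : C0Semigroup Z) : C0Semigroup W where
  toFun t := conjOp e (T.toFun t)
  map_zero := by
    ext x
    simp [conjOp_apply, T.map_zero_apply]
  map_add s t := by
    ext x
    simp [conjOp_apply, T.map_add_apply]
  continuous x := e.continuous.comp (T.continuous (e.symm x))

theorem genRel_conj_iff (e : Z ≃ₗᵢ[ℝ] W) (T : C0Semigroup Z) (x y : W) :
    (T.conj e).GenRel x y ↔ T.GenRel (e.symm x) (e.symm y) := by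
  unfold GenRel
  rw [e.symm.toHomeomorph.isInducing.tendsto_nhds_iff]
  refine tendsto_congr fun t => ?_
  simp [conj, conjOp_apply]

theorem hasEssGrowthBound_conj_iff (e : Z ≃ₗᵢ[ℝ] W) (T : C0Semigroup Z) (ω : EReal) :
    (T.conj e).HasEssGrowthBound ω ↔ T.HasEssGrowthBound ω := by
  simp only [HasEssGrowthBound, conj, essNorm_conjOp]

theorem HasEssGrowthBound.congr {S T : C0Semigroup Z} (h : ∀ t, S.toFun t = T.toFun t) {ω : EReal}
    (hT : T.HasEssGrowthBound ω) : S.HasEssGrowthBound ω := by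
  simpa only [HasEssGrowthBound, h] using hT

theorem hasEssGrowthBound_bot [Subsingleton Z] (T : C0Semigroup Z) :
    T.HasEssGrowthBound ⊥ := by
  refine tendsto_const_nhds.congr' ?_
  filter_upwards [eventually_gt_atTop 0] with t ht
  have ht' : (0 : ℝ) < t := ht
  rw [essNorm_of_subsingleton, ENNReal.log_zero,
    EReal.bot_div_of_pos_ne_top (EReal.coe_pos.2 ht') (EReal.coe_ne_top _)]

theorem tendsto_log_exp_div (η : ℝ) {c : ℝ} (hc : 0 < c) :
    Tendsto (fun t : ℝ≥0 => ENNReal.log (ENNReal.ofReal (c * Real.exp (-(η * t))))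
      / ((t : ℝ) : EReal)) atTop (𝓝 ((-η : ℝ) : EReal)) := by
  have h1 : Tendsto (fun t : ℝ≥0 => Real.log c / (t : ℝ) - η) atTop (𝓝 (-η)) := by
    have h := (tendsto_const_nhds (x := Real.log c)).div_atTop
      (NNReal.tendsto_coe_atTop.2 tendsto_id)
    simpa using h.sub_const η
  refine ((continuous_coe_real_ereal.tendsto _).comp h1).congr' ?_
  filter_upwards [eventually_gt_atTop 0] with t ht
  have ht' : (t : ℝ) ≠ 0 := (NNReal.coe_pos.2 ht).ne'
  rw [ENNReal.log_ofReal_of_pos (by positivity), ← EReal.coe_div,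
    Real.log_mul hc.ne' (Real.exp_pos _).ne', Real.log_exp, Function.comp_apply]
  congr 1
  field_simp
  ring

/-- The constants contribute `log c / t` and `log C / t`, which vanish in the limit. -/
theorem hasEssGrowthBound_of_le {T : C0Semigroup Z} {η c C : ℝ} (hc : 0 < c) (hC : 0 < C)
    (hl : ∀ t : ℝ≥0, ENNReal.ofReal (c * Real.exp (-(η * t))) ≤ essNorm (T.toFun t))
    (hu : ∀ t : ℝ≥0, essNorm (T.toFun t) ≤ ENNReal.ofReal (C * Real.exp (-(η * t)))) :
    T.HasEssGrowthBound ((-η : ℝ) : EReal) :=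
  tendsto_of_tendsto_of_tendsto_of_le_of_le (tendsto_log_exp_div η hc) (tendsto_log_exp_div η hC)
    (fun t => EReal.div_le_div_right_of_nonneg (EReal.coe_nonneg.2 t.coe_nonneg)
      (ENNReal.log_monotone (hl t)))
    (fun t => EReal.div_le_div_right_of_nonneg (EReal.coe_nonneg.2 t.coe_nonneg)
      (ENNReal.log_monotone (hu t)))

end C0Semigroup

end Abstract

/-! ### Two-sided bounds for the essential norm of the solution operators -/

section EssentialNorm

variable {η : ℝ} {E : Type*} [NormedAddCommGroup E] [NormedSpace ℝ E]

/-- After weighting, the `k`-th function is a tent of half-width one centred at `-k`; at `-j` the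
`j`-th tent has norm one and all others vanish. -/
theorem exists_separated_sequence [Nontrivial E] :
    ∃ u : ℕ → BUC η E, (∀ k, ‖u k‖ ≤ 1) ∧ ∀ j k, j ≠ k → 1 ≤ ‖u j - u k‖ := by
  obtain ⟨v, hv⟩ := exists_norm_eq E zero_le_one
  have huc : ∀ k : ℕ, UniformContinuous fun θ : Iic (0 : ℝ) => max 0 (1 - |(θ : ℝ) + k|) :=
    fun k => (LipschitzWith.id.const_max 0).uniformContinuous.comp
      (uniformContinuous_const.sub (Real.uniformContinuous_abs.comp
        (uniformContinuous_subtype_val.add uniformContinuous_const)))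
  have hle : ∀ (k : ℕ) (θ : Iic (0 : ℝ)), ‖max 0 (1 - |(θ : ℝ) + k|)‖ ≤ 1 := fun k θ => by
    rw [Real.norm_of_nonneg (le_max_left _ _)]
    exact max_le zero_le_one (by linarith [abs_nonneg ((θ : ℝ) + k)])
  have hucv : ∀ k : ℕ, UniformContinuous fun θ : Iic (0 : ℝ) => max 0 (1 - |(θ : ℝ) + k|) • v :=
    fun k => uniformContinuous_smul_of_bounded (huc k) uniformContinuous_const (hle k)
      (fun _ => hv.le)
  have hlev : ∀ (k : ℕ) (θ : Iic (0 : ℝ)), ‖max 0 (1 - |(θ : ℝ) + k|) • v‖ ≤ 1 := fun k θ => by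
    rw [norm_smul, hv, mul_one]
    exact hle k θ
  set g : ℕ → Iic (0 : ℝ) →ᵇ E := fun k => BoundedContinuousFunction.ofNormedAddCommGroup
    (fun θ : Iic (0 : ℝ) => max 0 (1 - |(θ : ℝ) + k|) • v) (hucv k).continuous 1 (hlev k) with hg
  have hmem : ∀ k, ∃ φ : BUC η E, weighted η E φ = g k := fun k => by
    have h : g k ∈ range (weighted η E) := by
      rw [range_weighted]
      exact hucv k
    exact h
  choose u hu using hmem
  refine ⟨u, fun k => ?_, fun j k hjk => ?_⟩
  · rw [← norm_weighted, hu]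
    exact BoundedContinuousFunction.norm_ofNormedAddCommGroup_le _ zero_le_one (hlev k)
  · rw [← norm_weighted, map_sub, hu, hu]
    refine le_trans ?_ ((g j - g k).norm_coe_le_norm ⟨-(j : ℝ), mem_Iic.mpr (by simp)⟩)
    have h1 : g j ⟨-(j : ℝ), mem_Iic.mpr (by simp)⟩ = v := by simp [hg]
    have h2 : g k ⟨-(j : ℝ), mem_Iic.mpr (by simp)⟩ = 0 := by
      have h3 : (1 : ℝ) ≤ |-(j : ℝ) + k| := by
        have h4 : (-(j : ℤ) + k : ℤ) ≠ 0 := by omega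
        have h5 := Int.one_le_abs h4
        exact_mod_cast h5
      have h6 : max 0 (1 - |-(j : ℝ) + k|) = 0 := max_eq_left (by linarith)
      change max 0 (1 - |-(j : ℝ) + k|) • v = 0
      rw [h6, zero_smul]
    rw [BoundedContinuousFunction.sub_apply, h1, h2, sub_zero, hv]

variable (hη : 0 ≤ η) (L : BUC η E →L[ℝ] E)

/-- The value `φ(θ)` reappears in the solution at `θ - t`, where the weight is smaller by the factor
`exp (-η t)`. -/
theorem norm_le_exp_mul_norm_solution [CompleteSpace E] (t : ℝ≥0) (φ : BUC η E) :
    ‖φ‖ ≤ Real.exp (η * t) * ‖solution hη L t φ‖ := by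
  refine BUC.norm_le (by positivity) fun θ => ?_
  have hθ : (θ : ℝ) ≤ 0 := θ.2
  have h := (solution hη L t φ).norm_apply_le
    ⟨(θ : ℝ) - t, mem_Iic.mpr (by linarith [t.coe_nonneg])⟩
  rw [solution_apply_apply] at h
  simp only [sub_add_cancel] at h
  rw [max_eq_right hθ, primitive_zero, add_zero, IicExtend_coe (f := φ)] at h
  refine le_trans (le_of_eq ?_) (mul_le_mul_of_nonneg_left h (Real.exp_pos (η * t)).le)
  rw [← mul_assoc, ← Real.exp_add]
  ring_nf

theorem le_essNorm_solution [CompleteSpace E] [Nontrivial E] (t : ℝ≥0) :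
    ENNReal.ofReal (1 / 2 * Real.exp (-(η * t))) ≤ essNorm (solution hη L t) := by
  obtain ⟨u, hu, hsep⟩ := exists_separated_sequence (η := η) (E := E)
  have h := le_noncompactnessMeasure (S := solution hη L t '' Metric.closedBall 0 1)
    (ε := Real.exp (-(η * t))) (u := fun k => solution hη L t (u k))
    (fun k => mem_image_of_mem _ (by simpa using hu k)) (fun j k hjk => by
      rw [dist_eq_norm, ← map_sub]
      have h := (hsep j k hjk).trans (norm_le_exp_mul_norm_solution hη L t (u j - u k))
      rw [Real.exp_neg, inv_le_iff_one_le_mul₀ (Real.exp_pos _), mul_comm]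
      exact h)
  rwa [div_eq_inv_mul, ← one_div] at h

/-- The solution `x` of the delay equation on `[0, t]`. -/
def trajectory [CompleteSpace E] (t : ℝ≥0) (φ : BUC η E) : Icc (0 : ℝ) t →ᵇ E :=
  BoundedContinuousFunction.mkOfCompact
    ⟨fun s => φ origin + primitive (rate L) (resolvent hη L φ) s,
      continuous_const.add
        ((continuous_primitive (rate_pos L).le _).comp continuous_subtype_val)⟩

theorem trajectory_apply [CompleteSpace E] (t : ℝ≥0) (φ : BUC η E) (s : Icc (0 : ℝ) t) :
    trajectory hη L t φ s = φ origin + primitive (rate L) (resolvent hη L φ) s := rfl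

theorem norm_resolvent_apply_le [CompleteSpace E] {φ : BUC η E} (hφ : ‖φ‖ ≤ 1) :
    ‖resolvent hη L φ‖ ≤ ‖resolvent hη L‖ :=
  ((resolvent hη L).le_opNorm φ).trans (mul_le_of_le_one_right (norm_nonneg _) hφ)

/-- Arzelà–Ascoli: on the unit ball the densities are bounded by `‖resolvent hη L‖`, so the
trajectories are uniformly bounded and share a Lipschitz constant. Finite dimension makes closed
balls of `E` compact. -/
theorem totallyBounded_trajectory [FiniteDimensional ℝ E] [CompleteSpace E] (t : ℝ≥0) :
    TotallyBounded (trajectory hη L t '' Metric.closedBall 0 1) := by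
  have : ProperSpace E := FiniteDimensional.proper ℝ E
  set M := ‖resolvent hη L‖ with hM
  set R := 1 + M * Real.exp (rate L * t) / rate L with hR
  have hrate := rate_pos L
  refine (BoundedContinuousFunction.arzela_ascoli (Metric.closedBall (0 : E) R)
    (isCompact_closedBall _ _) _ ?_ ?_).totallyBounded.subset subset_closure
  · rintro _ s ⟨φ, hφ, rfl⟩
    have hφ' : ‖φ‖ ≤ 1 := by simpa using hφ
    rw [mem_closedBall_zero_iff, trajectory_apply]
    refine (norm_add_le _ _).trans (add_le_add (φ.norm_origin_le.trans hφ') ?_)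
    refine (norm_primitive_le hrate _ s.2.1).trans ?_
    have h1 := norm_resolvent_apply_le hη L hφ'
    have h2 : (s : ℝ) ≤ t := s.2.2
    gcongr
  · refine (LipschitzWith.uniformEquicontinuous _ (M * Real.exp (rate L * t)).toNNReal
      ?_).equicontinuous
    rintro ⟨_, φ, hφ, rfl⟩
    have hφ' : ‖φ‖ ≤ 1 := by simpa using hφ
    refine LipschitzWith.of_dist_le_mul fun x y => ?_
    rw [Real.coe_toNNReal _ (by positivity), dist_eq_norm, Subtype.dist_eq, Real.dist_eq]
    change ‖trajectory hη L t φ x - trajectory hη L t φ y‖ ≤ _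
    rw [trajectory_apply, trajectory_apply, add_sub_add_left_eq_sub]
    refine (norm_primitive_sub_le hrate.le _ x.2.2 y.2.2).trans ?_
    have h1 := norm_resolvent_apply_le hη L hφ'
    gcongr

/-- The two functions agree on `[-t, 0]`. Further left they are `φ(θ + t)` and the constant `φ(0)`,
each of weighted size at most `exp (-η t)`. -/
theorem norm_solution_sub_segment_le [CompleteSpace E] (t : ℝ≥0) {φ : BUC η E} (hφ : ‖φ‖ ≤ 1) :
    ‖solution hη L t φ - segment hη t (trajectory hη L t φ)‖ ≤ 2 * Real.exp (-(η * t)) := by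
  refine BUC.norm_le (by positivity) fun θ => ?_
  rw [BUC.sub_apply, solution_apply_apply, segment_apply, trajectory_apply, projIcc_eq_max,
    add_comm (t : ℝ), add_sub_add_right_eq_sub]
  rcases le_total 0 ((θ : ℝ) + t) with h | h
  · rw [φ.IicExtend_of_nonneg h, sub_self, norm_zero, mul_zero]
    positivity
  · rw [IicExtend_of_mem _ (mem_Iic.mpr h)]
    have h1 := φ.norm_apply_le ⟨(θ : ℝ) + t, mem_Iic.mpr h⟩
    have h2 := φ.norm_origin_le.trans hφ
    have h3 : Real.exp (η * θ) = Real.exp (-(η * t)) * Real.exp (η * (θ + t)) := by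
      rw [← Real.exp_add]; ring_nf
    have h4 : Real.exp (η * (θ + t)) ≤ 1 :=
      Real.exp_le_one_iff.2 (mul_nonpos_of_nonneg_of_nonpos hη h)
    rw [h3, mul_assoc, mul_comm 2]
    refine mul_le_mul_of_nonneg_left ?_ (Real.exp_pos _).le
    refine (mul_le_mul_of_nonneg_left (norm_sub_le _ _) (Real.exp_pos _).le).trans ?_
    rw [mul_add]
    have h5 := mul_le_mul h4 h2 (norm_nonneg _) zero_le_one
    simp only at h1
    linarith

theorem essNorm_solution_le [FiniteDimensional ℝ E] [CompleteSpace E] (t : ℝ≥0) :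
    essNorm (solution hη L t) ≤ ENNReal.ofReal (3 * Real.exp (-(η * t))) := by
  classical
  have hexp := Real.exp_pos (-(η * t))
  -- A net of mesh `exp (-η t)`, added to the error `2 exp (-η t)`, accounts for the constant `3`.
  obtain ⟨F, hF, hcover⟩ := Metric.totallyBounded_iff.1 (totallyBounded_trajectory hη L t) _ hexp
  refine noncompactnessMeasure_le (by positivity) (hF.toFinset.image (segment hη t)) ?_
  rintro _ ⟨φ, hφ, rfl⟩
  obtain ⟨y, hyF, hy⟩ := mem_iUnion₂.1 (hcover (mem_image_of_mem _ hφ))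
  refine mem_iUnion₂.2 ⟨segment hη t y,
    Finset.mem_image_of_mem _ (hF.mem_toFinset.2 hyF), ?_⟩
  have h1 := norm_solution_sub_segment_le hη L t (φ := φ) (by simpa using hφ)
  rw [← dist_eq_norm] at h1
  have h2 := dist_segment_le hη t (trajectory hη L t φ) y
  have h3 := dist_triangle (solution hη L t φ) (segment hη t (trajectory hη L t φ))
    (segment hη t y)
  rw [Metric.mem_closedBall]
  linarith [Metric.mem_ball.1 hy]

/-- The essential growth bound of the solution semigroup does not depend on the delay term. -/
theorem exists_hasEssGrowthBound [FiniteDimensional ℝ E] [CompleteSpace E] :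
    ∃ ω : EReal, ω ≤ ((-η : ℝ) : EReal) ∧
      ∀ L : BUC η E →L[ℝ] E, (solutionSemigroup hη L).HasEssGrowthBound ω := by
  -- If `E` is trivial there is no separated sequence, and the growth bound is `-∞` instead of `-η`.
  rcases subsingleton_or_nontrivial E with hE | hE
  · have : Subsingleton (BUC η E) := ⟨fun _ _ => BUC.ext fun _ => Subsingleton.elim _ _⟩
    exact ⟨⊥, bot_le, fun L => C0Semigroup.hasEssGrowthBound_bot _⟩
  · exact ⟨_, le_rfl, fun L => C0Semigroup.hasEssGrowthBound_of_le one_half_pos zero_lt_three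
      (le_essNorm_solution hη L) (essNorm_solution_le hη L)⟩

end EssentialNorm

/-! ### Graphs of the operators and transfer to the closure of the domain -/

theorem mem_graph_part_iff {Z : Type*} [NormedAddCommGroup Z] [NormedSpace ℝ Z]
    (B : Z →ₗ.[ℝ] Z) (Y : Submodule ℝ Z) (x y : Y) :
    (x, y) ∈ (part B Y).graph ↔ ((x : Z), (y : Z)) ∈ B.graph := by
  rw [LinearPMap.mem_graph_iff, LinearPMap.mem_graph_iff]
  constructor
  · rintro ⟨u, rfl, rfl⟩
    exact ⟨⟨u.1, u.2.choose⟩, rfl, rfl⟩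
  · rintro ⟨u, hu, hy⟩
    have hx : (x : Z) ∈ B.domain := by
      have h := u.2
      rwa [hu] at h
    have hux : u = ⟨x, hx⟩ := Subtype.ext hu
    subst hux
    exact ⟨⟨x, hx, hy ▸ y.2⟩, rfl, Subtype.ext hy⟩

section Operators

variable {η : ℝ} {E : Type*} [NormedAddCommGroup E] [NormedSpace ℝ E]

theorem mem_graph_opA_iff (x y : State η E) :
    (x, y) ∈ (opA η E).graph ↔
      x.fst = 0 ∧ IsDerivative x.snd y.snd ∧ y.fst = -y.snd origin := by
  rw [LinearPMap.mem_graph_iff]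
  constructor
  · rintro ⟨u, rfl, rfl⟩
    exact ⟨u.2.1, derivative_spec η E ⟨u.1.snd, u.2.2⟩, rfl⟩
  · rintro ⟨h1, h2, h3⟩
    refine ⟨⟨x, h1, y.snd, h2⟩, rfl, ?_⟩
    have h4 : derivative η E ⟨x.snd, y.snd, h2⟩ = y.snd := (derivative_spec η E _).unique h2
    change WithLp.toLp 1 (-(derivative η E ⟨x.snd, y.snd, h2⟩ origin),
      derivative η E ⟨x.snd, y.snd, h2⟩) = y
    rw [h4, ← h3]
    rfl

theorem mem_graph_opA_add_opL_iff (L : BUC η E →L[ℝ] E) (x y : State η E) :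
    (x, y) ∈ (opA η E + opL L).graph ↔
      x.fst = 0 ∧ IsDerivative x.snd y.snd ∧ y.fst = -y.snd origin + L x.snd := by
  have hval : ∀ u : ((opA η E).domain ⊓ (opL L).domain : Submodule ℝ (State η E)),
      (opA η E + opL L) u = opA η E ⟨u, u.2.1⟩ + WithLp.toLp 1 (L u.1.snd, 0) := fun u => rfl
  have hgr := fun z => mem_graph_opA_iff x z
  simp only [LinearPMap.mem_graph_iff] at hgr
  rw [LinearPMap.mem_graph_iff]
  constructor
  · rintro ⟨u, rfl, rfl⟩
    obtain ⟨h1, h2, h3⟩ := (hgr _).1 ⟨⟨u, u.2.1⟩, rfl, rfl⟩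
    have hsnd : ((opA η E + opL L) u).snd = (opA η E ⟨u, u.2.1⟩).snd := by
      rw [hval, WithLp.add_snd]
      exact add_zero _
    have hfst : ((opA η E + opL L) u).fst = (opA η E ⟨u, u.2.1⟩).fst + L u.1.snd := by
      rw [hval, WithLp.add_fst]
      rfl
    rw [hsnd, hfst, h3]
    exact ⟨h1, h2, rfl⟩
  · rintro ⟨h1, h2, h3⟩
    obtain ⟨u, hu, hy⟩ := (hgr (WithLp.toLp 1 (-y.snd origin, y.snd))).2 ⟨h1, h2, rfl⟩
    refine ⟨⟨u, u.2, Submodule.le_topologicalClosure _ u.2⟩, hu, ?_⟩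
    rw [hval]
    change opA η E u + WithLp.toLp 1 (L u.1.snd, 0) = y
    rw [hy, hu, ← WithLp.toLp_add, Prod.mk_add_mk, add_zero, ← h3]
    rfl

variable (η E) in
/-- The isometric embedding `φ ↦ (0, φ)`. -/
def inclusion : BUC η E →ₗᵢ[ℝ] State η E where
  toFun φ := WithLp.toLp 1 (0, φ)
  map_add' φ ψ := by rw [← WithLp.toLp_add, Prod.mk_add_mk, add_zero]
  map_smul' c φ := by rw [RingHom.id_apply, ← WithLp.toLp_smul, Prod.smul_mk, smul_zero]
  norm_map' φ := by
    rw [WithLp.prod_norm_eq_of_L1]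
    simp

variable [CompleteSpace E]

/-- No mollification is needed: the generator for `L = 0` is densely defined, and its domain
consists of functions in `BUC_η¹`. -/
theorem dense_BUC1 (hη : 0 ≤ η) : Dense (BUC1 η E : Set (BUC η E)) :=
  (C0Semigroup.dense_genRel (solutionSemigroup hη (0 : BUC η E →L[ℝ] E))).mono
    fun _ hφ => hφ.imp fun _ h => (IsDerivative.of_genRel hη 0 h).1

theorem mem_closDom_iff (hη : 0 ≤ η) (x : State η E) : x ∈ closDom η E ↔ x.fst = 0 := by
  constructor
  · intro hx
    have hclosed : IsClosed {x : State η E | x.fst = 0} :=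
      isClosed_eq (WithLp.continuous_fst 1 _ _) continuous_const
    exact closure_minimal (fun y hy => hy.1) hclosed hx
  · intro hx
    have h := map_mem_closure (inclusion η E).continuous (dense_BUC1 hη x.snd)
      (t := (opA η E).domain) (fun φ hφ => show _ ∧ _ from ⟨rfl, hφ⟩)
    have e : inclusion η E x.snd = x := by
      change WithLp.toLp 1 (0, x.snd) = x
      rw [← hx]
      rfl
    rw [e] at h
    exact h

section

variable (hη : 0 ≤ η)

/-- The identification of `BUC_η` with the closure `{0} × BUC_η` of the domain of `A`. -/
def equivClosDom : BUC η E ≃ₗᵢ[ℝ] closDom η E where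
  toFun φ := ⟨inclusion η E φ, (mem_closDom_iff hη _).2 rfl⟩
  map_add' φ ψ := Subtype.ext (map_add (inclusion η E) φ ψ)
  map_smul' c φ := Subtype.ext (map_smul (inclusion η E) c φ)
  invFun x := x.1.snd
  left_inv _ := rfl
  right_inv x := Subtype.ext (by
    change WithLp.toLp 1 (0, x.1.snd) = x.1
    rw [← (mem_closDom_iff hη x.1).1 x.2]
    rfl)
  norm_map' φ := (inclusion η E).norm_map φ

theorem equivClosDom_symm_apply (x : closDom η E) :
    (equivClosDom hη).symm x = x.1.snd := rfl

/-- The solution semigroup of the delay equation, on the closure of the domain of `A`. -/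
def closDomSemigroup (L : BUC η E →L[ℝ] E) : C0Semigroup (closDom η E) :=
  (solutionSemigroup hη L).conj (equivClosDom hη)

/-- For values in the closure of the domain the first component `-ψ(0) + L φ` must vanish, which is
exactly the boundary condition of the solution semigroup. -/
theorem hasGenerator_part_opA_add_opL (L : BUC η E →L[ℝ] E) :
    (closDomSemigroup hη L).HasGenerator (part (opA η E + opL L) (closDom η E)) := by
  intro x y
  have h := C0Semigroup.genRel_conj_iff (equivClosDom hη) (solutionSemigroup hη L) x y
  rw [genRel_solutionSemigroup_iff, equivClosDom_symm_apply, equivClosDom_symm_apply] at h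
  refine Iff.trans ?_ h.symm
  rw [mem_graph_part_iff, mem_graph_opA_add_opL_iff, (mem_closDom_iff hη _).1 x.2,
    (mem_closDom_iff hη _).1 y.2, neg_add_eq_sub, eq_comm (a := (0 : E)) (b := _ - _),
    sub_eq_zero, eq_comm (a := L _)]
  simp

theorem hasGenerator_part_opA :
    (closDomSemigroup hη (0 : BUC η E →L[ℝ] E)).HasGenerator
      (part (opA η E) (closDom η E)) := by
  intro x y
  refine Iff.trans ?_ (hasGenerator_part_opA_add_opL hη 0 x y)
  rw [mem_graph_part_iff, mem_graph_part_iff, mem_graph_opA_add_opL_iff, mem_graph_opA_iff]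
  simp

end

/-- Carries a bound computed for the explicit semigroup over to an arbitrary semigroup with the same
generator. -/
theorem HasGenerator.hasEssGrowthBound (hη : 0 ≤ η) {S T : C0Semigroup (closDom η E)}
    {B : closDom η E →ₗ.[ℝ] closDom η E} (hS : S.HasGenerator B) (hT : T.HasGenerator B)
    {ω : EReal} (h : T.HasEssGrowthBound ω) : S.HasEssGrowthBound ω := by
  have : CompleteSpace (closDom η E) :=
    (completeSpace_congr (e := (equivClosDom hη).toEquiv)
      (equivClosDom hη).isometry.isUniformEmbedding).1 inferInstance
  exact h.congr (C0Semigroup.eq_of_genRel fun x y hxy => (hT x y).1 ((hS x y).2 hxy))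

end Operators

end InfiniteDelay

end

theorem lemma4p4 {E : Type*} [NormedAddCommGroup E] [NormedSpace ℝ E] [FiniteDimensional ℝ E]
    (η : ℝ) (hη : 0 ≤ η) (Lhat : InfiniteDelay.BUC η E →L[ℝ] E) :
    (∃ S : InfiniteDelay.C0Semigroup (InfiniteDelay.closDom η E),
      S.HasGenerator (InfiniteDelay.part (InfiniteDelay.opA η E) (InfiniteDelay.closDom η E))) ∧
    (∃ T : InfiniteDelay.C0Semigroup (InfiniteDelay.closDom η E),
      T.HasGenerator (InfiniteDelay.part (InfiniteDelay.opA η E + InfiniteDelay.opL Lhat)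
        (InfiniteDelay.closDom η E))) ∧
    ∀ S T : InfiniteDelay.C0Semigroup (InfiniteDelay.closDom η E),
      S.HasGenerator (InfiniteDelay.part (InfiniteDelay.opA η E) (InfiniteDelay.closDom η E)) →
      T.HasGenerator (InfiniteDelay.part (InfiniteDelay.opA η E + InfiniteDelay.opL Lhat)
        (InfiniteDelay.closDom η E)) →
      ∃ ω₀ ω₁ : EReal, S.HasEssGrowthBound ω₀ ∧ T.HasEssGrowthBound ω₁ ∧
        ω₁ ≤ ω₀ ∧ ω₀ ≤ ((-η : ℝ) : EReal) := by
  have : CompleteSpace E := FiniteDimensional.complete ℝ E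
  have hA := InfiniteDelay.hasGenerator_part_opA (E := E) hη
  have hAL := InfiniteDelay.hasGenerator_part_opA_add_opL hη Lhat
  refine ⟨⟨_, hA⟩, ⟨_, hAL⟩, fun S T hS hT => ?_⟩
  obtain ⟨ω, hω, h⟩ := InfiniteDelay.exists_hasEssGrowthBound (E := E) hη
  have key := fun L : InfiniteDelay.BUC η E →L[ℝ] E =>
    (InfiniteDelay.C0Semigroup.hasEssGrowthBound_conj_iff (InfiniteDelay.equivClosDom hη)
      (InfiniteDelay.solutionSemigroup hη L) ω).2 (h L)
  -- The same `ω` serves for both semigroups, so the first inequality is in fact an equality.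
  exact ⟨ω, ω, InfiniteDelay.HasGenerator.hasEssGrowthBound hη hS hA (key 0),
    InfiniteDelay.HasGenerator.hasEssGrowthBound hη hT hAL (key Lhat), le_rfl, hω⟩
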